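/- **Setting.** Let $A$ be a $C^*$-algebra and $k\in\mathbb N_0$. A $C^*$-correspondence over $A$ is a (right) Hilbert $C^*$-module $E$ over $A$ with a left action of $A$ by a $*$-homomorphism $\phi$ into the adjointable operators on $E$ that is essential, i.e. $\phi(A)E$ spans a dense subspace of $E$. Let $\mathbb E$ be a product system of $C^*$-correspondences over $\mathbb N_0^k$: a family of correspondences $\mathbb E(n)$, $n\in\mathbb N_0^k$, with $\mathbb E(0)=A$, and associative multiplications $\mathbb E(m)\times\mathbb E(n)\to\mathbb E(m+n)$ that induce isomorphisms of correspondences $\mathbb E(m)\otimes_A\mathbb E(n)\cong\mathbb E(m+n)$ and are the module actions if $m=0$ or $n=0$. Write $E_i=\mathbb E(e_i)$ and let $t_{i,j}:E_i\otimes E_j\to E_j\otimes E_i$ be the isomorphism obtained from the two identifications with $\mathbb E(e_i+e_j)$. An isometric representation of $\mathbb E$ on a Hilbert space $H$ is a tuple $(\sigma,T^{(1)},\dots,T^{(k)})$, where $\sigma$ is a nondegenerate $*$-representation of $A$ on $H$ and the $T^{(i)}:E_i\to B(H)$ are linear maps with $T^{(i)}(a\xi b)=\sigma(a)T^{(i)}(\xi)\sigma(b)$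 and $T^{(i)}(\xi)^*T^{(i)}(\eta)=\sigma(\langle\xi,\eta\rangle)$, such that the isometries $\widetilde T^{(i)}:E_i\otimes_\sigma H\to H$, $\xi\otimes h\mapsto T^{(i)}(\xi)h$, satisfy $$\widetilde T^{(i)}(I_{E_i}\otimes\widetilde T^{(j)})=\widetilde T^{(j)}(I_{E_j}\otimes\widetilde T^{(i)})(t_{i,j}\otimes I_H)\qquad(1\le i,j\le k).$$ It is doubly commuting if, for all $i\ne j$, $$\widetilde T^{(j)*}\widetilde T^{(i)}=(I_{E_j}\otimes\widetilde T^{(i)})(t_{i,j}\otimes I_H)(I_{E_i}\otimes\widetilde T^{(j)*}),$$ and $(\sigma,T^{(i)})$ is fully coisometric if $\widetilde T^{(i)}\widetilde T^{(i)*}=I_H$. A closed subspace $K\subseteq H$ is reducing if $K$ and $K^\perp$ are invariant under all $\sigma(a)$ and all $T^{(i)}(\xi)$; the restriction of the representation to $K$ is then called its summand on $K$. For $\alpha\subseteq\{1,\dots,k\}$ let $\mathbb E_\alpha$ be the product subsystem given by the $E_i$, $i\in\alpha$. An induced representation of $\mathbb E_\alpha$ is one on a Hilbert space $\mathcal F(\mathbb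 E_\alpha)\otimes_\pi K_0$, where $\pi$ is a nondegenerate representation of $A$ on a Hilbert space $K_0$ and $\mathcal F(\mathbb E_\alpha)=\bigoplus_n\mathbb E(n)$ (the sum over all $n\in\mathbb N_0^k$ with $n_i=0$ for $i\notin\alpha$) is the Fock module; $a\in A$ acts on it by the left action $\phi_\infty(a)\otimes I$, and $\xi\in E_i$, $i\in\alpha$, by the creation operator $T_\xi\otimes I$, $\eta\otimes h\mapsto\xi\eta\otimes h$. **Statement.** Let $(\sigma,T^{(1)},\dots,T^{(k)})$ be an isometric representation of $\mathbb E$ on a Hilbert space $H$. For each $\alpha\subseteq\{1,\dots,k\}$ let $H_\alpha$ be the largest closed subspace $K$ of $H$ (it exists) such that 1. $K$ is reducing for $(\sigma,T^{(1)},\dots,T^{(k)})$; 2. $(\sigma,T^{(i)}:i\in\alpha)|_K$ is isomorphic to an induced representation of $\mathbb E_\alpha$; 3. $(\sigma,T^{(i)})|_K$ is fully coisometric for each $i\in\{1,\dots,k\}\setminus\alpha$. Then the subspaces $H_\alpha$ are pairwise orthogonal, and $H_{dc}=\bigoplus_{\alpha\subseteq\{1,\dots,k\}}H_\alpha$ is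 the largest reducing subspace of $H$ on which the summand of $(\sigma,T^{(1)},\dots,T^{(k)})$ is doubly commuting; that is, $H_{dc}$ is such a subspace and contains every other one. -/

import Mathlib

noncomputable section

namespace Wold

universe w

open scoped TensorProduct InnerProductSpace

set_option linter.unusedSectionVars false

/-! ### `C*`-correspondences -/

/-- A `C*`-correspondence over `A`: a (right) Hilbert `C*`-module `F` over `A` (Mathlib's
`CStarModule` over `Aᵐᵒᵖ`; completeness of `F` is a separate instance argument wherever it is used)
with an essential left action of `A` by adjointable operators.
The action is a `*`-homomorphism by `adjoint_left`; right `A`-linearity and boundedness of each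
`left a` are consequences of adjointability. -/
class CStarCorrespondence (A F : Type*) [NonUnitalCStarAlgebra A] [PartialOrder A]
    [NormedAddCommGroup F] [NormedSpace ℂ F] [SMul Aᵐᵒᵖ F] extends CStarModule Aᵐᵒᵖ F where
  left : A →ₙₐ[ℂ] Module.End ℂ F
  adjoint_left : ∀ (a : A) (ξ η : F), inner (left a ξ) η = inner ξ (left (star a) η)
  essential : Dense (Submodule.span ℂ {ζ : F | ∃ (a : A) (ξ : F), left a ξ = ζ} : Set F)

section Correspondence

variable {A F : Type*} [NonUnitalCStarAlgebra A] [PartialOrder A]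
  [NormedAddCommGroup F] [NormedSpace ℂ F] [SMul Aᵐᵒᵖ F] [CStarCorrespondence A F]

variable (A) in
/-- The `A`-valued inner product, linear in the second variable: `⟨ξ, η a⟩ = ⟨ξ, η⟩ a`. -/
def ip (ξ η : F) : A := MulOpposite.unop (inner Aᵐᵒᵖ ξ η)

/-- The left action `a ξ = φ(a) ξ`. -/
def lact (a : A) (ξ : F) : F := CStarCorrespondence.left a ξ

/-- The right action `ξ a`. -/
def ract (ξ : F) (a : A) : F := MulOpposite.op a • ξ

lemma ip_add_right (x y z : F) : ip A x (y + z) = ip A x y + ip A x z := by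
  simp [ip]

lemma ip_add_left (x y z : F) : ip A (x + y) z = ip A x z + ip A y z := by
  simp [ip]

lemma ip_smul_right (c : ℂ) (x y : F) : ip A x (c • y) = c • ip A x y := by
  simp [ip]

lemma ip_smul_left (c : ℂ) (x y : F) : ip A (c • x) y = star c • ip A x y := by
  simp [ip]

lemma ip_star (x y : F) : star (ip A x y) = ip A y x := by
  rw [ip, ip, ← MulOpposite.unop_star, CStarModule.star_inner]

lemma ip_ract_right (x y : F) (a : A) : ip A x (ract y a) = ip A x y * a := by
  simp [ip, ract]

lemma ip_ract_left (x y : F) (a : A) : ip A (ract x a) y = star a * ip A x y := by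
  simp [ip, ract]

lemma ip_lact (a : A) (x y : F) : ip A (lact a x) y = ip A x (lact (star a) y) := by
  simp only [ip, lact, CStarCorrespondence.adjoint_left]

lemma ip_self_nonneg (x : F) : 0 ≤ ip A x x := by
  have := CStarModule.inner_self_nonneg (A := Aᵐᵒᵖ) (x := x)
  exact this

lemma ip_sum_right {ι : Type*} (s : Finset ι) (x : F) (y : ι → F) :
    ip A x (∑ i ∈ s, y i) = ∑ i ∈ s, ip A x (y i) :=
  map_sum (AddMonoidHom.mk' (fun z => ip A x z) (ip_add_right x)) y s

lemma ip_sum_left {ι : Type*} (s : Finset ι) (x : ι → F) (y : F) :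
    ip A (∑ i ∈ s, x i) y = ∑ i ∈ s, ip A (x i) y :=
  map_sum (AddMonoidHom.mk' (fun z => ip A z y) (fun a b => ip_add_left a b y)) x s

lemma lact_add (a : A) (x y : F) : lact a (x + y) = lact a x + lact a y := by simp [lact]
lemma lact_smul (a : A) (c : ℂ) (x : F) : lact a (c • x) = c • lact a x := by simp [lact]
lemma lact_mul (a b : A) (x : F) : lact (a * b) x = lact a (lact b x) := by simp [lact]

/-- A selfadjoint `M` of a `C*`-algebra has a negative part `N`; it vanishes iff `M` is positive. -/
lemma exists_neg_part {B : Type*} [NonUnitalCStarAlgebra B] [PartialOrder B] [StarOrderedRing B]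
    (M : B) (hM : IsSelfAdjoint M) :
    ∃ N c : B, star N = N ∧ N = star c * c ∧ N * M * N = -(N * N * N) ∧
      (N = 0 → ∃ b, M = star b * b) := by
  have hN := CFC.negPart_nonneg M
  obtain ⟨c, hc⟩ := CStarAlgebra.nonneg_iff_eq_star_mul_self.mp hN
  refine ⟨M⁻, c, (IsSelfAdjoint.of_nonneg hN).star_eq, hc, ?_, fun h => ?_⟩
  · have h1 : M⁺ * M⁻ = 0 := CFC.posPart_mul_negPart M
    have h2 : M = M⁺ - M⁻ := (CFC.posPart_sub_negPart M hM).symm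
    calc M⁻ * M * M⁻ = M⁻ * (M⁺ - M⁻) * M⁻ := by rw [← h2]
      _ = M⁻ * (M⁺ * M⁻) - M⁻ * M⁻ * M⁻ := by noncomm_ring
      _ = _ := by rw [h1]; simp
  · exact CStarAlgebra.nonneg_iff_eq_star_mul_self.mp
      (CStarAlgebra.nonneg_iff_isSelfAdjoint_and_negPart_eq_zero.mpr ⟨hM, h⟩)

/-- The Gram matrix of finitely many vectors of a Hilbert `C*`-module is positive, in the form
`⟨ξ i, ξ j⟩ = ∑ l, (B l i)* (B l j)`. -/
lemma exists_gram [StarOrderedRing A] {ι : Type*} [Fintype ι] (ξ : ι → F) :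
    ∃ B : ι → ι → A, ∀ i j, ip A (ξ i) (ξ j) = ∑ l, star (B l i) * B l j := by
  classical
  let M : CStarMatrix ι ι A := CStarMatrix.ofMatrix fun i j => ip A (ξ i) (ξ j)
  have hMsa : IsSelfAdjoint M := by
    ext i j
    rw [CStarMatrix.star_apply]
    exact ip_star _ _
  obtain ⟨N, c, hNsa, hc, hprod, hfin⟩ := exists_neg_part M hMsa
  have hcube : N * N * N = star (c * N) * (c * N) := by
    rw [star_mul, hNsa, hc]; noncomm_ring
  have hdiag : ∀ i, (N * M * N) i i = ip A (∑ p, ract (ξ p) (N p i)) (∑ p, ract (ξ p) (N p i)) := by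
    intro i
    have hs : ∀ p, N i p = star (N p i) := fun p => by
      conv_lhs => rw [← hNsa]
      rw [CStarMatrix.star_apply]
    simp only [CStarMatrix.mul_apply, ip_sum_left, ip_sum_right, ip_ract_left, ip_ract_right,
      Finset.sum_mul]
    refine Finset.sum_congr rfl fun p _ => Finset.sum_congr rfl fun q _ => ?_
    rw [hs]; rfl
  have hzero : c * N = 0 := by
    have key : ∀ i, ∑ p, star ((c * N) p i) * (c * N) p i = 0 := by
      intro i
      apply le_antisymm
      · have h := ip_self_nonneg (A := A) (∑ p, ract (ξ p) (N p i))
        rw [← hdiag, hprod, hcube] at h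
        have h2 : (-(star (c * N) * (c * N))) i i = - ∑ p, star ((c * N) p i) * (c * N) p i := by
          change -((star (c * N) * (c * N)) i i) = _
          rw [CStarMatrix.mul_apply]
          simp only [CStarMatrix.star_apply]
        rw [h2] at h
        exact neg_nonneg.mp h
      · exact Finset.sum_nonneg fun p _ => star_mul_self_nonneg _
    ext p i
    have := (Finset.sum_eq_zero_iff_of_nonneg fun p _ => star_mul_self_nonneg _).mp (key i) p
      (Finset.mem_univ _)
    exact CStarRing.star_mul_self_eq_zero_iff _ |>.mp this
  have hN0 : N = 0 := by
    have : star (N * N) * (N * N) = 0 := by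
      rw [star_mul, hNsa]
      calc N * N * (N * N) = N * (N * N * N) := by noncomm_ring
        _ = 0 := by rw [hcube, hzero]; simp
    have h3 := (CStarRing.star_mul_self_eq_zero_iff _).mp this
    have h4 : star N * N = 0 := by rw [hNsa, h3]
    exact (CStarRing.star_mul_self_eq_zero_iff _).mp h4
  obtain ⟨B, hB⟩ := hfin hN0
  refine ⟨fun l i => B l i, fun i j => ?_⟩
  have : M i j = (star B * B) i j := by rw [← hB]
  rw [CStarMatrix.mul_apply] at this
  simp only [CStarMatrix.star_apply] at this
  exact this

end Correspondence

/-! ### The Hilbert space `F ⊗_σ H` -/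

section Tensor

variable {A F H : Type*} [NonUnitalCStarAlgebra A] [PartialOrder A] [StarOrderedRing A]
  [NormedAddCommGroup F] [NormedSpace ℂ F] [SMul Aᵐᵒᵖ F] [CStarCorrespondence A F]
  [NormedAddCommGroup H] [InnerProductSpace ℂ H] [CompleteSpace H]

/-- The sesquilinear form on `F ⊗ H` with `⟨ξ ⊗ h, η ⊗ g⟩ = ⟨h, σ(⟨ξ, η⟩) g⟩`. -/
def tensorForm (F : Type*) [NormedAddCommGroup F] [NormedSpace ℂ F] [SMul Aᵐᵒᵖ F]
    [CStarCorrespondence A F] (σ : A →⋆ₙₐ[ℂ] (H →L[ℂ] H)) :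
    F ⊗[ℂ] H →ₗ⋆[ℂ] F ⊗[ℂ] H →ₗ[ℂ] ℂ :=
  TensorProduct.lift <| LinearMap.mk₂'ₛₗ (starRingEnd ℂ) (starRingEnd ℂ)
    (fun (ξ : F) (h : H) => TensorProduct.lift <| LinearMap.mk₂ ℂ
      (fun (η : F) (g : H) => ⟪h, σ (ip A ξ η) g⟫_ℂ)
      (fun η η' g => by simp [ip_add_right])
      (fun c η g => by simp [ip_smul_right])
      (fun η g g' => by simp)
      (fun c η g => by simp))
    (fun ξ ξ' h => by ext; simp [ip_add_left])
    (fun c ξ h => by ext; simp [ip_smul_left])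
    (fun ξ h h' => by ext; simp)
    (fun c ξ h => by ext; simp [mul_comm])

lemma tensorForm_tmul (σ : A →⋆ₙₐ[ℂ] (H →L[ℂ] H)) (ξ η : F) (h g : H) :
    tensorForm F σ (ξ ⊗ₜ h) (η ⊗ₜ g) = ⟪h, σ (ip A ξ η) g⟫_ℂ := rfl

lemma exists_sum_tmul (x : F ⊗[ℂ] H) :
    ∃ (n : ℕ) (ξ : Fin n → F) (h : Fin n → H), x = ∑ i, ξ i ⊗ₜ[ℂ] h i := by
  obtain ⟨S, rfl⟩ := TensorProduct.exists_finset x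
  refine ⟨S.card, fun i => (S.equivFin.symm i).1.1, fun i => (S.equivFin.symm i).1.2, ?_⟩
  rw [Equiv.sum_comp S.equivFin.symm (fun s => s.1.1 ⊗ₜ[ℂ] s.1.2), Finset.sum_coe_sort S
    (fun s => s.1 ⊗ₜ[ℂ] s.2)]

lemma inner_rep_star_mul (σ : A →⋆ₙₐ[ℂ] (H →L[ℂ] H)) (a b : A) (h g : H) :
    ⟪h, σ (star a * b) g⟫_ℂ = ⟪σ a h, σ b g⟫_ℂ := by
  rw [map_mul, map_star, ContinuousLinearMap.star_eq_adjoint, _root_.mul_apply_eq_comp,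
    ContinuousLinearMap.adjoint_inner_right]

/-- The form on `F ⊗ H` as a sum of squares, with `B` depending on `x` only through `ξ`. -/
lemma tensorForm_sum {ι : Type*} [Fintype ι] (ξ : ι → F) (B : ι → ι → A)
    (hB : ∀ i j, ip A (ξ i) (ξ j) = ∑ l, star (B l i) * B l j)
    (σ : A →⋆ₙₐ[ℂ] (H →L[ℂ] H)) (h : ι → H) :
    tensorForm F σ (∑ i, ξ i ⊗ₜ h i) (∑ i, ξ i ⊗ₜ h i) =
      ((∑ l, ‖∑ i, σ (B l i) (h i)‖ ^ 2 : ℝ) : ℂ) := by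
  have e : ∀ l, ((‖∑ i, σ (B l i) (h i)‖ ^ 2 : ℝ) : ℂ) =
      ∑ i, ∑ j, ⟪σ (B l i) (h i), σ (B l j) (h j)⟫_ℂ := fun l => by
    have := inner_self_eq_norm_sq_to_K (𝕜 := ℂ) (∑ i, σ (B l i) (h i))
    simp only [sum_inner, inner_sum] at this
    rw [Finset.sum_comm, this]; push_cast; rfl
  rw [Complex.ofReal_sum]
  simp only [e, map_sum, LinearMap.sum_apply, tensorForm_tmul, hB, _root_.sum_apply,
    inner_sum, inner_rep_star_mul]
  conv_rhs => rw [Finset.sum_comm]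
  conv_lhs => rw [Finset.sum_comm]
  refine Finset.sum_congr rfl fun i _ => ?_
  rw [Finset.sum_comm]

lemma tensorForm_symm (σ : A →⋆ₙₐ[ℂ] (H →L[ℂ] H)) (x y : F ⊗[ℂ] H) :
    starRingEnd ℂ (tensorForm F σ y x) = tensorForm F σ x y := by
  induction x with
  | zero => simp
  | add x x' hx hx' => simp [hx, hx']
  | tmul ξ h =>
    induction y with
    | zero => simp
    | add y y' hy hy' => simp [hy, hy']
    | tmul η g =>
      rw [tensorForm_tmul, tensorForm_tmul, inner_conj_symm, ← ip_star, map_star,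
        ContinuousLinearMap.star_eq_adjoint, ContinuousLinearMap.adjoint_inner_left]

lemma tensorForm_nonneg (σ : A →⋆ₙₐ[ℂ] (H →L[ℂ] H)) (x : F ⊗[ℂ] H) :
    0 ≤ RCLike.re (tensorForm F σ x x) := by
  obtain ⟨n, ξ, h, rfl⟩ := exists_sum_tmul x
  obtain ⟨B, hB⟩ := exists_gram (A := A) ξ
  rw [tensorForm_sum ξ B hB]
  change (0 : ℝ) ≤ ∑ l, ‖∑ i, σ (B l i) (h i)‖ ^ 2
  exact Finset.sum_nonneg fun _ _ => sq_nonneg _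

/-- The algebraic tensor product `F ⊗ H` with the semi-inner product of `tensorForm`. -/
def PreTensor (F : Type*) [NormedAddCommGroup F] [NormedSpace ℂ F] [SMul Aᵐᵒᵖ F]
    [CStarCorrespondence A F] (_σ : A →⋆ₙₐ[ℂ] (H →L[ℂ] H)) : Type _ := F ⊗[ℂ] H

namespace PreTensor

variable (σ : A →⋆ₙₐ[ℂ] (H →L[ℂ] H))

instance : AddCommGroup (PreTensor F σ) := inferInstanceAs (AddCommGroup (F ⊗[ℂ] H))
instance : Module ℂ (PreTensor F σ) := inferInstanceAs (Module ℂ (F ⊗[ℂ] H))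

instance core : PreInnerProductSpace.Core ℂ (PreTensor F σ) where
  inner x y := tensorForm F σ x y
  conj_inner_symm x y := tensorForm_symm σ x y
  re_inner_nonneg x := tensorForm_nonneg σ x
  add_left x y z := by
    exact congrArg (fun f => f z) ((tensorForm F σ).map_add x y)
  smul_left x y c := by
    exact congrArg (fun f => f y) ((tensorForm F σ).map_smulₛₗ c x)

instance : SeminormedAddCommGroup (PreTensor F σ) :=
  InnerProductSpace.Core.toSeminormedAddCommGroup (𝕜 := ℂ)

instance : InnerProductSpace ℂ (PreTensor F σ) := InnerProductSpace.ofCore (core σ)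

end PreTensor

/-- The Hilbert space `F ⊗_σ H`: the Hausdorff completion of the algebraic tensor product with
respect to `⟨ξ ⊗ h, η ⊗ g⟩ = ⟨h, σ(⟨ξ, η⟩) g⟩`. -/
abbrev Tensor (F : Type*) [NormedAddCommGroup F] [NormedSpace ℂ F] [SMul Aᵐᵒᵖ F]
    [CStarCorrespondence A F] (σ : A →⋆ₙₐ[ℂ] (H →L[ℂ] H)) : Type _ :=
  UniformSpace.Completion (PreTensor F σ)

namespace Tensor

variable (σ : A →⋆ₙₐ[ℂ] (H →L[ℂ] H))

/-- The canonical map from the algebraic tensor product. -/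
def ofAlg : F ⊗[ℂ] H →ₗ[ℂ] Tensor F σ :=
  (UniformSpace.Completion.toComplₗᵢ (𝕜 := ℂ) (E := PreTensor F σ)).toLinearMap

/-- The elementary tensor `ξ ⊗ h`. -/
def tmul (ξ : F) (h : H) : Tensor F σ := ofAlg σ (ξ ⊗ₜ h)

lemma inner_ofAlg (x y : F ⊗[ℂ] H) : ⟪ofAlg σ x, ofAlg σ y⟫_ℂ = tensorForm F σ x y :=
  UniformSpace.Completion.inner_coe (𝕜 := ℂ) (E := PreTensor F σ) x y

lemma inner_tmul (ξ η : F) (h g : H) :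
    ⟪tmul σ ξ h, tmul σ η g⟫_ℂ = ⟪h, σ (ip A ξ η) g⟫_ℂ :=
  inner_ofAlg σ _ _

lemma norm_tmul_le (ξ : F) (h : H) : ‖tmul σ ξ h‖ ≤ ‖ξ‖ * ‖h‖ := by
  refine le_of_sq_le_sq ?_ (by positivity)
  have h1 : ‖ip A ξ ξ‖ = ‖ξ‖ ^ 2 := (CStarModule.norm_sq_eq (A := Aᵐᵒᵖ) (x := ξ)).symm
  rw [← inner_self_eq_norm_sq (𝕜 := ℂ), inner_tmul]
  calc _ ≤ ‖h‖ * ‖σ (ip A ξ ξ) h‖ := (RCLike.re_le_norm _).trans (norm_inner_le_norm _ _)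
    _ ≤ ‖h‖ * (‖ξ‖ ^ 2 * ‖h‖) := by
        gcongr
        refine (ContinuousLinearMap.le_opNorm _ _).trans ?_
        gcongr
        exact (NonUnitalStarAlgHom.norm_apply_le σ _).trans h1.le
    _ = _ := by ring

lemma norm_sq_ofAlg (x : F ⊗[ℂ] H) : ((‖ofAlg σ x‖ ^ 2 : ℝ) : ℂ) = tensorForm F σ x x := by
  rw [← inner_ofAlg, inner_self_eq_norm_sq_to_K]; push_cast; rfl

lemma denseRange_ofAlg : DenseRange (ofAlg (F := F) σ) :=
  UniformSpace.Completion.denseRange_coe (α := PreTensor F σ)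

/-- Two bounded maps that agree on elementary tensors are equal. -/
lemma ext {X : Type*} [NormedAddCommGroup X] [NormedSpace ℂ X] {f g : Tensor F σ →L[ℂ] X}
    (h : ∀ ξ v, f (tmul σ ξ v) = g (tmul σ ξ v)) : f = g := by
  have : f.toLinearMap ∘ₗ ofAlg σ = g.toLinearMap ∘ₗ ofAlg σ := TensorProduct.ext' h
  ext x
  refine congrFun ((denseRange_ofAlg σ).equalizer f.continuous g.continuous ?_) x
  exact congrArg DFunLike.coe this

section lift

variable {X : Type*} [NormedAddCommGroup X] [InnerProductSpace ℂ X] [CompleteSpace X]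

/-- The bounded operator on `F ⊗_σ H` with `ξ ⊗ h ↦ f ξ h`, for a bilinear map `f` whose
linearization is bounded. -/
def lift (f : F →ₗ[ℂ] H →ₗ[ℂ] X) : Tensor F σ →L[ℂ] X :=
  (TensorProduct.lift f).extendOfNorm (ofAlg σ)

lemma lift_ofAlg (f : F →ₗ[ℂ] H →ₗ[ℂ] X)
    (hf : ∃ C, ∀ x : F ⊗[ℂ] H, ‖TensorProduct.lift f x‖ ≤ C * ‖ofAlg σ x‖) (x : F ⊗[ℂ] H) :
    lift σ f (ofAlg σ x) = TensorProduct.lift f x :=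
  LinearMap.extendOfNorm_eq (denseRange_ofAlg σ) hf x

lemma inner_lift (f : F →ₗ[ℂ] H →ₗ[ℂ] X)
    (hf : ∀ ξ η h g, ⟪f ξ h, f η g⟫_ℂ = ⟪h, σ (ip A ξ η) g⟫_ℂ) (x y : F ⊗[ℂ] H) :
    ⟪TensorProduct.lift f x, TensorProduct.lift f y⟫_ℂ = ⟪ofAlg σ x, ofAlg σ y⟫_ℂ := by
  rw [inner_ofAlg]
  induction x with
  | zero => simp
  | add x x' hx hx' => simp only [map_add, LinearMap.add_apply, hx, hx', inner_add_left]
  | tmul ξ h =>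
    induction y with
    | zero => simp
    | add y y' hy hy' => rw [map_add, map_add, inner_add_right, hy, hy']
    | tmul η g => rw [tensorForm_tmul, TensorProduct.lift.tmul, TensorProduct.lift.tmul, hf]

lemma norm_lift (f : F →ₗ[ℂ] H →ₗ[ℂ] X)
    (hf : ∀ ξ η h g, ⟪f ξ h, f η g⟫_ℂ = ⟪h, σ (ip A ξ η) g⟫_ℂ) (x : F ⊗[ℂ] H) :
    ‖TensorProduct.lift f x‖ = ‖ofAlg σ x‖ := by
  rw [norm_eq_sqrt_re_inner (𝕜 := ℂ), inner_lift σ f hf, ← norm_eq_sqrt_re_inner]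

/-- The isometry on `F ⊗_σ H` with `ξ ⊗ h ↦ f ξ h`, if `f` respects the inner products. -/
def liftIsometry (f : F →ₗ[ℂ] H →ₗ[ℂ] X)
    (hf : ∀ ξ η h g, ⟪f ξ h, f η g⟫_ℂ = ⟪h, σ (ip A ξ η) g⟫_ℂ) : Tensor F σ →ₗᵢ[ℂ] X where
  toLinearMap := (lift σ f).toLinearMap
  norm_map' x := by
    refine (denseRange_ofAlg σ).induction_on (p := fun x => ‖lift σ f x‖ = ‖x‖) x
      (isClosed_eq (lift σ f).continuous.norm continuous_norm) fun y => ?_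
    rw [lift_ofAlg σ f ⟨1, fun x => by rw [norm_lift σ f hf, one_mul]⟩, norm_lift σ f hf]

lemma liftIsometry_tmul (f : F →ₗ[ℂ] H →ₗ[ℂ] X)
    (hf : ∀ ξ η h g, ⟪f ξ h, f η g⟫_ℂ = ⟪h, σ (ip A ξ η) g⟫_ℂ) (ξ : F) (h : H) :
    liftIsometry σ f hf (tmul σ ξ h) = f ξ h :=
  lift_ofAlg σ f ⟨1, fun x => by rw [norm_lift σ f hf, one_mul]⟩ _

end lift

/-- The bilinear map `(ξ, h) ↦ ξ ⊗ h`. -/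
def mk (F : Type*) [NormedAddCommGroup F] [NormedSpace ℂ F] [SMul Aᵐᵒᵖ F]
    [CStarCorrespondence A F] (σ : A →⋆ₙₐ[ℂ] (H →L[ℂ] H)) : F →ₗ[ℂ] H →ₗ[ℂ] Tensor F σ :=
  (TensorProduct.mk ℂ F H).compr₂ (ofAlg σ)

lemma mk_apply (ξ : F) (h : H) : mk F σ ξ h = tmul σ ξ h := rfl

section map

variable {H' : Type*} [NormedAddCommGroup H'] [InnerProductSpace ℂ H'] [CompleteSpace H']

/-- `I ⊗ S : F ⊗_σ H → F ⊗_σ' H'` for an operator `S` that intertwines `σ` and `σ'`. -/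
def map (F : Type*) [NormedAddCommGroup F] [NormedSpace ℂ F] [SMul Aᵐᵒᵖ F]
    [CStarCorrespondence A F] (σ : A →⋆ₙₐ[ℂ] (H →L[ℂ] H)) (σ' : A →⋆ₙₐ[ℂ] (H' →L[ℂ] H'))
    (S : H →L[ℂ] H') : Tensor F σ →L[ℂ] Tensor F σ' :=
  lift σ ((mk F σ').compl₂ S.toLinearMap)

lemma map_tmul (σ' : A →⋆ₙₐ[ℂ] (H' →L[ℂ] H')) (S : H →L[ℂ] H')
    (hS : ∀ a h, S (σ a h) = σ' a (S h)) (ξ : F) (h : H) :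
    map F σ σ' S (tmul σ ξ h) = tmul σ' ξ (S h) := by
  refine lift_ofAlg σ _ ⟨‖S‖, fun x => ?_⟩ _
  obtain ⟨n, ξ, h, rfl⟩ := exists_sum_tmul x
  obtain ⟨B, hB⟩ := exists_gram (A := A) ξ
  have e : TensorProduct.lift ((mk F σ').compl₂ S.toLinearMap) (∑ i, ξ i ⊗ₜ[ℂ] h i) =
      ofAlg σ' (∑ i, ξ i ⊗ₜ[ℂ] S (h i)) := by
    simp only [map_sum, TensorProduct.lift.tmul]; rfl
  rw [e]
  refine le_of_sq_le_sq ?_ (by positivity)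
  have h1 := norm_sq_ofAlg σ' (∑ i, ξ i ⊗ₜ[ℂ] S (h i))
  have h2 := norm_sq_ofAlg σ (∑ i, ξ i ⊗ₜ[ℂ] h i)
  rw [tensorForm_sum ξ B hB, Complex.ofReal_inj] at h1 h2
  rw [mul_pow, h1, h2, Finset.mul_sum]
  refine Finset.sum_le_sum fun l _ => ?_
  rw [← mul_pow]
  gcongr
  simp only [← hS, ← map_sum]
  exact S.le_opNorm _

end map

section left

/-- The action of `a` on the algebraic tensor product. -/
def preLeft (F H : Type*) [NormedAddCommGroup F] [NormedSpace ℂ F] [SMul Aᵐᵒᵖ F]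
    [CStarCorrespondence A F] [NormedAddCommGroup H] [InnerProductSpace ℂ H] (a : A) :
    F ⊗[ℂ] H →ₗ[ℂ] F ⊗[ℂ] H :=
  TensorProduct.map (CStarCorrespondence.left a) LinearMap.id

lemma preLeft_add (a b : A) : preLeft F H (a + b) = preLeft F H a + preLeft F H b := by
  simp [preLeft, TensorProduct.map_add_left]

lemma preLeft_smul (c : ℂ) (a : A) : preLeft F H (c • a) = c • preLeft F H a := by
  simp [preLeft, TensorProduct.map_smul_left]

lemma preLeft_mul (a b : A) (x : F ⊗[ℂ] H) :
    preLeft F H (a * b) x = preLeft F H a (preLeft F H b x) := by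
  have : preLeft F H (a * b) = preLeft F H a ∘ₗ preLeft F H b := by
    ext; simp [preLeft]
  rw [this]; rfl

lemma tensorForm_preLeft (a : A) (x y : F ⊗[ℂ] H) :
    tensorForm F σ (preLeft F H a x) y = tensorForm F σ x (preLeft F H (star a) y) := by
  induction x with
  | zero => simp
  | add x x' hx hx' => simp [hx, hx']
  | tmul ξ h =>
    induction y with
    | zero => simp
    | add y y' hy hy' => simp only [map_add, hy, hy']
    | tmul η g =>
      change ⟪h, σ (ip A (lact a ξ) η) g⟫_ℂ = ⟪h, σ (ip A ξ (lact (star a) η)) g⟫_ℂ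
      rw [ip_lact]

/-- In the unitization of `A`, `‖a‖² - a* a = (z + b)* (z + b)` for some `z + b`. -/
lemma exists_sqrt_norm_sub (a : A) : ∃ (z : ℂ) (b : A),
    star z * z = (‖a‖ ^ 2 : ℝ) ∧ star z • b + z • star b + star b * b = -(star a * a) := by
  let _ : PartialOrder (Unitization ℂ A) := CStarAlgebra.spectralOrder _
  have : StarOrderedRing (Unitization ℂ A) := CStarAlgebra.spectralOrderedRing _
  have h := CStarAlgebra.star_mul_le_algebraMap_norm_sq (a := (a : Unitization ℂ A))
  rw [← sub_nonneg, CStarAlgebra.nonneg_iff_eq_star_mul_self] at h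
  obtain ⟨c, hc⟩ := h
  have h0 : (Unitization.inl ((‖a‖ ^ 2 : ℝ) : ℂ) : Unitization ℂ A) =
      star c * c + star (a : Unitization ℂ A) * a := by
    rw [← hc, Unitization.norm_inr, sub_add_cancel]; rfl
  refine ⟨c.fst, c.snd, ?_, ?_⟩
  · have := congrArg (fun u => u.fst) h0
    simpa using this.symm
  · have := congrArg (fun u => u.snd) h0
    simp only [Unitization.snd_inl, Unitization.snd_add, Unitization.snd_mul,
      Unitization.snd_star, Unitization.fst_star, Unitization.snd_inr, Unitization.fst_inr,
      star_zero, zero_smul, zero_add] at this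
    exact eq_neg_of_add_eq_zero_left this.symm

lemma norm_preLeft_le (a : A) (x : F ⊗[ℂ] H) :
    ‖ofAlg σ (preLeft F H a x)‖ ≤ ‖a‖ * ‖ofAlg σ x‖ := by
  obtain ⟨z, b, hz, hb⟩ := exists_sqrt_norm_sub a
  refine le_of_sq_le_sq ?_ (by positivity)
  have key : tensorForm F σ (z • x + preLeft F H b x) (z • x + preLeft F H b x) =
      ((‖a‖ ^ 2 : ℝ) : ℂ) * tensorForm F σ x x -
        tensorForm F σ (preLeft F H a x) (preLeft F H a x) := by
    have e2 : tensorForm F σ (preLeft F H a x) (preLeft F H a x) =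
        -tensorForm F σ x (preLeft F H (-(star a * a)) x) := by
      rw [tensorForm_preLeft, ← preLeft_mul, ← neg_one_smul ℂ (star a * a), preLeft_smul]
      simp
    rw [e2, ← hb, ← hz]
    simp only [map_add, preLeft_add, preLeft_smul, LinearMap.add_apply, LinearMap.smul_apply,
      map_smul, preLeft_mul, tensorForm_preLeft, LinearMap.map_smulₛₗ, smul_eq_mul]
    simp only [starRingEnd_apply]
    ring
  rw [← norm_sq_ofAlg, ← norm_sq_ofAlg, ← norm_sq_ofAlg] at key
  norm_cast at key
  rw [mul_pow]
  nlinarith [sq_nonneg ‖ofAlg σ (z • x + preLeft F H b x)‖]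

lemma lift_left (a : A) : TensorProduct.lift ((mk F σ).comp (CStarCorrespondence.left a)) =
    ofAlg σ ∘ₗ preLeft F H a := TensorProduct.ext' fun _ _ => rfl

/-- `φ(a) ⊗ I` on `F ⊗_σ H`. -/
def leftCLM (a : A) : Tensor F σ →L[ℂ] Tensor F σ :=
  lift σ ((mk F σ).comp (CStarCorrespondence.left a))

lemma leftCLM_ofAlg (a : A) (x : F ⊗[ℂ] H) :
    leftCLM σ a (ofAlg σ x) = ofAlg σ (preLeft F H a x) := by
  rw [leftCLM, lift_ofAlg, lift_left]
  · rfl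
  · exact ⟨‖a‖, fun x => by rw [lift_left]; exact norm_preLeft_le σ a x⟩

lemma leftCLM_tmul (a : A) (ξ : F) (h : H) :
    leftCLM σ a (tmul σ ξ h) = tmul σ (lact a ξ) h := leftCLM_ofAlg σ a _

lemma tmul_add (ξ η : F) (h : H) : tmul σ (ξ + η) h = tmul σ ξ h + tmul σ η h := by
  simp only [← mk_apply, map_add, LinearMap.add_apply]

lemma tmul_smul (c : ℂ) (ξ : F) (h : H) : tmul σ (c • ξ) h = c • tmul σ ξ h := by
  simp only [← mk_apply, map_smul, LinearMap.smul_apply]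

/-- The representation `a ↦ φ(a) ⊗ I` of `A` on `F ⊗_σ H`. -/
def left (F : Type*) [NormedAddCommGroup F] [NormedSpace ℂ F] [SMul Aᵐᵒᵖ F]
    [CStarCorrespondence A F] (σ : A →⋆ₙₐ[ℂ] (H →L[ℂ] H)) :
    A →⋆ₙₐ[ℂ] (Tensor F σ →L[ℂ] Tensor F σ) where
  toFun a := leftCLM σ a
  map_smul' c a := ext σ fun ξ v => by
    simp [leftCLM_tmul, lact, ← tmul_smul]
  map_zero' := ext σ fun ξ v => by
    rw [leftCLM_tmul]; simp [lact, tmul]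
  map_add' a b := ext σ fun ξ v => by
    simp [leftCLM_tmul, lact, ← tmul_add]
  map_mul' a b := ext σ fun ξ v => by
    simp [leftCLM_tmul, lact]
  map_star' a := by
    rw [ContinuousLinearMap.star_eq_adjoint, ContinuousLinearMap.eq_adjoint_iff]
    intro x y
    refine (denseRange_ofAlg σ).induction_on₂
      (p := fun x y => ⟪leftCLM σ (star a) x, y⟫_ℂ = ⟪x, leftCLM σ a y⟫_ℂ)
      (isClosed_eq (by fun_prop) (by fun_prop)) (fun x y => ?_) x y
    rw [leftCLM_ofAlg, leftCLM_ofAlg, inner_ofAlg, inner_ofAlg, tensorForm_preLeft, star_star]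

lemma left_tmul (a : A) (ξ : F) (h : H) :
    left F σ a (tmul σ ξ h) = tmul σ (lact a ξ) h := leftCLM_tmul σ a ξ h

end left

end Tensor

end Tensor

/-! ### Isometric representations of a correspondence -/

/-- The map `T` of an isometric representation `(σ, T)` of the correspondence `F` on `H`.
(Such a `T` is automatically completely contractive.) -/
structure IsometricMap {A H : Type*} [NonUnitalCStarAlgebra A] [PartialOrder A]
    [StarOrderedRing A] [NormedAddCommGroup H] [InnerProductSpace ℂ H] [CompleteSpace H]
    (F : Type*) [NormedAddCommGroup F] [NormedSpace ℂ F] [SMul Aᵐᵒᵖ F]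
    [CStarCorrespondence A F] (σ : A →⋆ₙₐ[ℂ] (H →L[ℂ] H)) where
  T : F →ₗ[ℂ] (H →L[ℂ] H)
  map_lact : ∀ (a : A) (ξ : F), T (lact a ξ) = σ a ∘L T ξ
  map_ract : ∀ (ξ : F) (a : A), T (ract ξ a) = T ξ ∘L σ a
  isometric : ∀ ξ η : F, ContinuousLinearMap.adjoint (T ξ) ∘L T η = σ (ip A ξ η)

namespace IsometricMap

variable {A F H : Type*} [NonUnitalCStarAlgebra A] [PartialOrder A] [StarOrderedRing A]
  [NormedAddCommGroup F] [NormedSpace ℂ F] [SMul Aᵐᵒᵖ F] [CStarCorrespondence A F]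
  [NormedAddCommGroup H] [InnerProductSpace ℂ H] [CompleteSpace H]
  {σ : A →⋆ₙₐ[ℂ] (H →L[ℂ] H)} (τ : IsometricMap F σ)

lemma inner_T (ξ η : F) (h g : H) : ⟪τ.T ξ h, τ.T η g⟫_ℂ = ⟪h, σ (ip A ξ η) g⟫_ℂ := by
  rw [← τ.isometric, ContinuousLinearMap.comp_apply, ContinuousLinearMap.adjoint_inner_right]

/-- The isometry `T~ : F ⊗_σ H → H` with `T~ (ξ ⊗ h) = T(ξ) h`. -/
def tildeIsometry : Tensor F σ →ₗᵢ[ℂ] H :=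
  Tensor.liftIsometry σ ((ContinuousLinearMap.coeLM ℂ).comp τ.T) τ.inner_T

/-- `T~` as a bounded operator. -/
def tilde : Tensor F σ →L[ℂ] H := τ.tildeIsometry.toContinuousLinearMap

lemma tilde_tmul (ξ : F) (h : H) : τ.tilde (Tensor.tmul σ ξ h) = τ.T ξ h :=
  Tensor.liftIsometry_tmul σ _ τ.inner_T ξ h

lemma tilde_left (a : A) (x : Tensor F σ) : τ.tilde (Tensor.left F σ a x) = σ a (τ.tilde x) := by
  have : τ.tilde ∘L Tensor.left F σ a = σ a ∘L τ.tilde := Tensor.ext σ fun ξ h => by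
    simp [Tensor.left_tmul, tilde_tmul, map_lact]
  exact congrArg (fun f => f x) this

end IsometricMap

/-! ### Product systems -/

/-- A product system of `C*`-correspondences over `A` indexed by `ℕ^k`. The fibres are the
correspondences `E n`; the multiplications `E m × E n → E (m + n)` are associative and induce
isomorphisms of correspondences `E m ⊗ E n ≅ E (m + n)` of the internal tensor products
(`ip_mul` and `dense_mul`, since `⟨ξ ⊗ η, ξ' ⊗ η'⟩ = ⟨η, ⟨ξ, ξ'⟩ η'⟩`); the fibre
`E 0` is the correspondence `A`, which multiplies by the module actions.
The index `p = m + n` is kept as a variable so that no transports between fibres are needed. -/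
structure ProductSystem (A : Type*) [NonUnitalCStarAlgebra A] [PartialOrder A]
    {k : ℕ} (E : (Fin k → ℕ) → Type*) [∀ n, NormedAddCommGroup (E n)] [∀ n, NormedSpace ℂ (E n)]
    [∀ n, SMul Aᵐᵒᵖ (E n)] [∀ n, CStarCorrespondence A (E n)] where
  mul : ∀ {m n p : Fin k → ℕ}, m + n = p → E m →ₗ[ℂ] E n →ₗ[ℂ] E p
  ip_mul : ∀ {m n p : Fin k → ℕ} (h : m + n = p) (ξ ξ' : E m) (η η' : E n),
    ip A (mul h ξ η) (mul h ξ' η') = ip A η (lact (ip A ξ ξ') η')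
  dense_mul : ∀ {m n p : Fin k → ℕ} (h : m + n = p),
    Dense (Submodule.span ℂ {ζ : E p | ∃ ξ η, mul h ξ η = ζ} : Set (E p))
  lact_mul : ∀ {m n p : Fin k → ℕ} (h : m + n = p) (a : A) (ξ : E m) (η : E n),
    lact a (mul h ξ η) = mul h (lact a ξ) η
  mul_ract : ∀ {m n p : Fin k → ℕ} (h : m + n = p) (ξ : E m) (η : E n) (a : A),
    ract (mul h ξ η) a = mul h ξ (ract η a)
  mul_assoc : ∀ {m n p mn np mnp : Fin k → ℕ} (h₁ : m + n = mn) (h₂ : mn + p = mnp)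
    (h₃ : n + p = np) (h₄ : m + np = mnp) (ξ : E m) (η : E n) (ζ : E p),
    mul h₂ (mul h₁ ξ η) ζ = mul h₄ ξ (mul h₃ η ζ)
  unit : A ≃ₗ[ℂ] E 0
  ip_unit : ∀ a b : A, ip A (unit a) (unit b) = star a * b
  unit_mul : ∀ {n : Fin k → ℕ} (h : 0 + n = n) (a : A) (ξ : E n), mul h (unit a) ξ = lact a ξ
  mul_unit : ∀ {n : Fin k → ℕ} (h : n + 0 = n) (ξ : E n) (a : A), mul h ξ (unit a) = ract ξ a

/-- The generator `e_i` of `ℕ^k`. -/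
abbrev gen {k : ℕ} (i : Fin k) : Fin k → ℕ := Pi.single i 1

namespace ProductSystem

variable {A : Type*} [NonUnitalCStarAlgebra A] [PartialOrder A] [StarOrderedRing A]
  {k : ℕ} {E : (Fin k → ℕ) → Type*} [∀ n, NormedAddCommGroup (E n)] [∀ n, NormedSpace ℂ (E n)]
  [∀ n, SMul Aᵐᵒᵖ (E n)] [∀ n, CStarCorrespondence A (E n)] (𝓔 : ProductSystem A E)
  {H : Type*} [NormedAddCommGroup H] [InnerProductSpace ℂ H] [CompleteSpace H]
  (σ : A →⋆ₙₐ[ℂ] (H →L[ℂ] H)) {m n p : Fin k → ℕ}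

lemma inner_creation_aux (h : m + n = p) (ξ ξ' : E m) (x y : E n ⊗[ℂ] H) :
    ⟪TensorProduct.lift ((Tensor.mk (E p) σ).comp (𝓔.mul h ξ)) x,
      TensorProduct.lift ((Tensor.mk (E p) σ).comp (𝓔.mul h ξ')) y⟫_ℂ =
    ⟪Tensor.ofAlg σ x, Tensor.left (E n) σ (ip A ξ ξ') (Tensor.ofAlg σ y)⟫_ℂ := by
  induction x with
  | zero => simp
  | add x x' hx hx' => simp only [map_add, inner_add_left, hx, hx']
  | tmul η v =>
    induction y with
    | zero => simp
    | add y y' hy hy' => simp only [map_add, inner_add_right, hy, hy']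
    | tmul η' v' =>
      change ⟪Tensor.tmul σ (𝓔.mul h ξ η) v, Tensor.tmul σ (𝓔.mul h ξ' η') v'⟫_ℂ =
        ⟪Tensor.tmul σ η v, Tensor.left (E n) σ (ip A ξ ξ') (Tensor.tmul σ η' v')⟫_ℂ
      rw [Tensor.left_tmul, Tensor.inner_tmul, Tensor.inner_tmul, 𝓔.ip_mul]

/-- The creation operator `T_ξ ⊗ I : E n ⊗_σ H → E (m + n) ⊗_σ H`, `η ⊗ h ↦ ξ η ⊗ h`. -/
def creation (h : m + n = p) (ξ : E m) : Tensor (E n) σ →L[ℂ] Tensor (E p) σ :=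
  Tensor.lift σ ((Tensor.mk (E p) σ).comp (𝓔.mul h ξ))

lemma creation_ofAlg (h : m + n = p) (ξ : E m) (x : E n ⊗[ℂ] H) :
    𝓔.creation σ h ξ (Tensor.ofAlg σ x) =
      TensorProduct.lift ((Tensor.mk (E p) σ).comp (𝓔.mul h ξ)) x := by
  refine Tensor.lift_ofAlg σ _ ⟨Real.sqrt ‖Tensor.left (E n) σ (ip A ξ ξ)‖, fun x => ?_⟩ x
  refine le_of_sq_le_sq ?_ (by positivity)
  rw [mul_pow, Real.sq_sqrt (norm_nonneg _), ← inner_self_eq_norm_sq (𝕜 := ℂ),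
    inner_creation_aux]
  calc _ ≤ ‖Tensor.ofAlg σ x‖ * ‖Tensor.left (E n) σ (ip A ξ ξ) (Tensor.ofAlg σ x)‖ :=
        (RCLike.re_le_norm _).trans (norm_inner_le_norm _ _)
    _ ≤ ‖Tensor.ofAlg σ x‖ * (‖Tensor.left (E n) σ (ip A ξ ξ)‖ * ‖Tensor.ofAlg σ x‖) := by
        gcongr; exact ContinuousLinearMap.le_opNorm _ _
    _ = _ := by ring

lemma creation_tmul (h : m + n = p) (ξ : E m) (η : E n) (v : H) :
    𝓔.creation σ h ξ (Tensor.tmul σ η v) = Tensor.tmul σ (𝓔.mul h ξ η) v :=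
  𝓔.creation_ofAlg σ h ξ _

lemma inner_creation (h : m + n = p) (ξ ξ' : E m) (x y : Tensor (E n) σ) :
    ⟪𝓔.creation σ h ξ x, 𝓔.creation σ h ξ' y⟫_ℂ =
      ⟪x, Tensor.left (E n) σ (ip A ξ ξ') y⟫_ℂ := by
  refine (Tensor.denseRange_ofAlg σ).induction_on₂
    (p := fun x y => ⟪𝓔.creation σ h ξ x, 𝓔.creation σ h ξ' y⟫_ℂ =
      ⟪x, Tensor.left (E n) σ (ip A ξ ξ') y⟫_ℂ)
    (isClosed_eq (by fun_prop) (by fun_prop)) (fun x y => ?_) x y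
  rw [creation_ofAlg, creation_ofAlg, inner_creation_aux]

/-- The bilinear map `(ξ, x) ↦ (T_ξ ⊗ I) x`. -/
def creationₗ (h : m + n = p) : E m →ₗ[ℂ] Tensor (E n) σ →ₗ[ℂ] Tensor (E p) σ :=
  LinearMap.mk₂ ℂ (fun ξ x => 𝓔.creation σ h ξ x)
    (fun ξ ξ' x => by
      have : 𝓔.creation σ h (ξ + ξ') = 𝓔.creation σ h ξ + 𝓔.creation σ h ξ' :=
        Tensor.ext σ fun η v => by simp [creation_tmul, ← Tensor.tmul_add]
      rw [this]; rfl)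
    (fun c ξ x => by
      have : 𝓔.creation σ h (c • ξ) = c • 𝓔.creation σ h ξ :=
        Tensor.ext σ fun η v => by simp [creation_tmul, ← Tensor.tmul_smul]
      rw [this]; rfl)
    (fun ξ x y => map_add _ x y) (fun c ξ x => map_smul _ c x)

/-- The isometry `E m ⊗ (E n ⊗_σ H) → E (m + n) ⊗_σ H`, `ξ ⊗ (η ⊗ h) ↦ ξ η ⊗ h`. -/
def assocIsometry (h : m + n = p) :
    Tensor (E m) (Tensor.left (E n) σ) →ₗᵢ[ℂ] Tensor (E p) σ :=
  Tensor.liftIsometry (Tensor.left (E n) σ) (𝓔.creationₗ σ h) (𝓔.inner_creation σ h)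

lemma assocIsometry_tmul (h : m + n = p) (ξ : E m) (x : Tensor (E n) σ) :
    𝓔.assocIsometry σ h (Tensor.tmul _ ξ x) = 𝓔.creation σ h ξ x :=
  Tensor.liftIsometry_tmul _ _ (𝓔.inner_creation σ h) ξ x

lemma assocIsometry_surjective (h : m + n = p) : Function.Surjective (𝓔.assocIsometry σ h) := by
  set f := 𝓔.assocIsometry σ h with hf
  have hclosed : IsClosed (Set.range f) := f.isometry.isClosedEmbedding.isClosed_range
  have hmem : ∀ (ζ : E p) (v : H), Tensor.tmul σ ζ v ∈ LinearMap.range f.toLinearMap := by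
    intro ζ v
    have hcont : Continuous fun ζ : E p => Tensor.tmul σ ζ v := by
      refine AddMonoidHomClass.continuous_of_bound ((Tensor.mk (E p) σ).flip v) ‖v‖ fun ζ => ?_
      rw [mul_comm]
      exact Tensor.norm_tmul_le σ ζ v
    have hcl : IsClosed {ζ : E p | Tensor.tmul σ ζ v ∈ Set.range f} := hclosed.preimage hcont
    have hsub : (Submodule.span ℂ {ζ : E p | ∃ ξ η, 𝓔.mul h ξ η = ζ}) ≤
        (LinearMap.range f.toLinearMap).comap ((Tensor.mk (E p) σ).flip v) := by
      rw [Submodule.span_le]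
      rintro _ ⟨ξ, η, rfl⟩
      exact ⟨Tensor.tmul _ ξ (Tensor.tmul σ η v), by
        change f _ = _
        rw [hf, assocIsometry_tmul, creation_tmul]; rfl⟩
    exact hcl.closure_subset_iff.mpr (fun ζ hζ => hsub hζ) (𝓔.dense_mul h ζ)
  have hrange : LinearMap.range (Tensor.ofAlg (F := E p) σ) ≤ LinearMap.range f.toLinearMap := by
    rintro _ ⟨x, rfl⟩
    induction x with
    | zero => simp
    | add x y hx hy => rw [map_add]; exact add_mem hx hy
    | tmul ζ v => exact hmem ζ v
  intro y
  exact hclosed.closure_subset_iff.mpr (fun z hz => hrange hz) (Tensor.denseRange_ofAlg σ y)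

/-- The unitary `E m ⊗ (E n ⊗_σ H) ≅ E (m + n) ⊗_σ H` given by the multiplication. -/
def assoc (h : m + n = p) : Tensor (E m) (Tensor.left (E n) σ) ≃ₗᵢ[ℂ] Tensor (E p) σ :=
  LinearIsometryEquiv.ofSurjective (𝓔.assocIsometry σ h) (𝓔.assocIsometry_surjective σ h)

lemma assoc_tmul (h : m + n = p) (ξ : E m) (x : Tensor (E n) σ) :
    𝓔.assoc σ h (Tensor.tmul _ ξ x) = 𝓔.creation σ h ξ x :=
  𝓔.assocIsometry_tmul σ h ξ x

/-- `t_{i,j} ⊗ I : E_i ⊗ (E_j ⊗_σ H) ≅ E_j ⊗ (E_i ⊗_σ H)`, where `t_{i,j} : E_i ⊗ E_j ≅ E_j ⊗ E_i`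
is the isomorphism of the two factorizations of the fibre over `e_i + e_j`. -/
def flip (i j : Fin k) :
    Tensor (E (gen i)) (Tensor.left (E (gen j)) σ) ≃ₗᵢ[ℂ]
      Tensor (E (gen j)) (Tensor.left (E (gen i)) σ) :=
  (𝓔.assoc σ (rfl : gen i + gen j = gen i + gen j)).trans
    (𝓔.assoc σ (add_comm (gen j) (gen i))).symm

/-- `t_{i,j} ⊗ I` as a bounded operator. -/
def flipL (i j : Fin k) :
    Tensor (E (gen i)) (Tensor.left (E (gen j)) σ) →L[ℂ]
      Tensor (E (gen j)) (Tensor.left (E (gen i)) σ) :=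
  (𝓔.flip σ i j).toLinearIsometry.toContinuousLinearMap

end ProductSystem

/-! ### Isometric representations of a product system -/

section Representation

variable {A : Type*} [NonUnitalCStarAlgebra A] [PartialOrder A] [StarOrderedRing A]
  {k : ℕ} {E : (Fin k → ℕ) → Type*} [∀ n, NormedAddCommGroup (E n)] [∀ n, NormedSpace ℂ (E n)]
  [∀ n, SMul Aᵐᵒᵖ (E n)] [∀ n, CStarCorrespondence A (E n)]
  {H : Type*} [NormedAddCommGroup H] [InnerProductSpace ℂ H] [CompleteSpace H]

/-- A representation of `A` on `H` is nondegenerate if the vectors `σ(a) h` span a dense subspace. -/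
def Nondegenerate (σ : A →⋆ₙₐ[ℂ] (H →L[ℂ] H)) : Prop :=
  Dense (Submodule.span ℂ {g : H | ∃ a h, σ a h = g} : Set H)

/-- An isometric representation `(σ, T⁽¹⁾, …, T⁽ᵏ⁾)` of the product system on `H`. -/
structure IsometricRep (𝓔 : ProductSystem A E) (H : Type*) [NormedAddCommGroup H]
    [InnerProductSpace ℂ H] [CompleteSpace H] where
  σ : A →⋆ₙₐ[ℂ] (H →L[ℂ] H)
  nondegenerate : Nondegenerate σ
  T : ∀ i : Fin k, IsometricMap (E (gen i)) σ
  /-- `T~⁽ⁱ⁾ (I ⊗ T~⁽ʲ⁾) = T~⁽ʲ⁾ (I ⊗ T~⁽ⁱ⁾) (t_{i,j} ⊗ I)` -/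
  comm : ∀ i j : Fin k,
    (T i).tilde ∘L Tensor.map (E (gen i)) (Tensor.left (E (gen j)) σ) σ (T j).tilde =
      (T j).tilde ∘L Tensor.map (E (gen j)) (Tensor.left (E (gen i)) σ) σ (T i).tilde ∘L
        𝓔.flipL σ i j

namespace IsometricRep

variable {𝓔 : ProductSystem A E} (ρ : IsometricRep 𝓔 H)

/-- `(σ, T⁽ⁱ⁾)` is fully coisometric: `T~⁽ⁱ⁾ T~⁽ⁱ⁾* = I`. -/
def FullyCoisometric (i : Fin k) : Prop :=
  (ρ.T i).tilde ∘L ContinuousLinearMap.adjoint (ρ.T i).tilde = ContinuousLinearMap.id ℂ H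

/-- `T~⁽ʲ⁾* T~⁽ⁱ⁾ = (I ⊗ T~⁽ⁱ⁾) (t_{i,j} ⊗ I) (I ⊗ T~⁽ʲ⁾*)` for all `i ≠ j`. -/
def DoublyCommuting : Prop :=
  ∀ i j : Fin k, i ≠ j →
    ContinuousLinearMap.adjoint (ρ.T j).tilde ∘L (ρ.T i).tilde =
      Tensor.map (E (gen j)) (Tensor.left (E (gen i)) ρ.σ) ρ.σ (ρ.T i).tilde ∘L
        𝓔.flipL ρ.σ i j ∘L
          Tensor.map (E (gen i)) ρ.σ (Tensor.left (E (gen j)) ρ.σ)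
            (ContinuousLinearMap.adjoint (ρ.T j).tilde)

/-- The index set `ℕ^{k,α} = {n : n_i = 0 for i ∉ α}` of the product subsystem given by the
`E_i`, `i ∈ α`. -/
abbrev SubIndex {k : ℕ} (α : Finset (Fin k)) : Type := {n : Fin k → ℕ // ∀ i, i ∉ α → n i = 0}

/-- `F(𝔼_α) ⊗_π K = ⨁ E n ⊗_π K`, the `ℓ²`-direct sum over `n ∈ ℕ^{k,α}`, where
`F(𝔼_α) = ⨁ E n` is the Fock module of the product subsystem `𝔼_α`. -/
abbrev Fock (E : (Fin k → ℕ) → Type*) [∀ n, NormedAddCommGroup (E n)] [∀ n, NormedSpace ℂ (E n)]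
    [∀ n, SMul Aᵐᵒᵖ (E n)] [∀ n, CStarCorrespondence A (E n)] (α : Finset (Fin k))
    {K : Type*} [NormedAddCommGroup K] [InnerProductSpace ℂ K] [CompleteSpace K]
    (π : A →⋆ₙₐ[ℂ] (K →L[ℂ] K)) : Type _ :=
  lp (fun n : SubIndex α => Tensor (E n.1) π) 2

/-- `(σ, T⁽ⁱ⁾ : i ∈ α)` is isomorphic to an induced representation of the subsystem `𝔼_α`: for some
nondegenerate representation `π` of `A` on a Hilbert space `K` there is a unitary
`U : F(𝔼_α) ⊗_π K → H` that intertwines `φ_∞(a) ⊗ I` with `σ(a)` and the Toeplitz creation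
operators `T_ξ ⊗ I`, `ξ ∈ E_i`, `i ∈ α`, with `T⁽ⁱ⁾(ξ)`. The operator `φ_∞(a) ⊗ I` acts in each
summand `E n ⊗ K` by the left action of `A` on `E n`, and `T_ξ ⊗ I` maps the summand of `n` to the
summand of `e_i + n` by `η ⊗ h ↦ ξ η ⊗ h`; the summands span a dense subspace. -/
def IsInduced {H : Type w} [NormedAddCommGroup H] [InnerProductSpace ℂ H] [CompleteSpace H]
    (ρ : IsometricRep 𝓔 H) (α : Finset (Fin k)) : Prop :=
  ∃ (K : Type w) (_ : NormedAddCommGroup K) (_ : InnerProductSpace ℂ K) (_ : CompleteSpace K)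
    (π : A →⋆ₙₐ[ℂ] (K →L[ℂ] K)) (U : Fock E α π ≃ₗᵢ[ℂ] H),
    Nondegenerate π ∧
    (∀ (a : A) (n : SubIndex α) (x : Tensor (E n.1) π),
      U (lp.single 2 n (Tensor.left (E n.1) π a x)) = ρ.σ a (U (lp.single 2 n x))) ∧
    (∀ i ∈ α, ∀ (ξ : E (gen i)) (n p : SubIndex α) (h : gen i + n.1 = p.1)
      (x : Tensor (E n.1) π),
      U (lp.single 2 p (𝓔.creation π h ξ x)) = (ρ.T i).T ξ (U (lp.single 2 n x)))

/-- The closed subspace `K` reduces the representation. -/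
structure Reduces (K : Submodule ℂ H) : Prop where
  isClosed : IsClosed (K : Set H)
  σ_mem : ∀ (a : A), ∀ h ∈ K, ρ.σ a h ∈ K
  σ_mem_orthogonal : ∀ (a : A), ∀ h ∈ Kᗮ, ρ.σ a h ∈ Kᗮ
  T_mem : ∀ (i : Fin k) (ξ : E (gen i)), ∀ h ∈ K, (ρ.T i).T ξ h ∈ K
  T_mem_orthogonal : ∀ (i : Fin k) (ξ : E (gen i)), ∀ h ∈ Kᗮ, (ρ.T i).T ξ h ∈ Kᗮ

section restrict

variable {ρ} {K : Submodule ℂ H} (hK : ρ.Reduces K)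

lemma Reduces.completeSpace {K : Submodule ℂ H} (hK : ρ.Reduces K) : CompleteSpace K := hK.isClosed.completeSpace_coe

variable [CompleteSpace K]

/-- The restriction of `σ` to a reducing subspace. -/
def restrictσ : A →⋆ₙₐ[ℂ] (K →L[ℂ] K) where
  toFun a := (ρ.σ a).restrict (hK.σ_mem a)
  map_smul' c a := by ext; simp
  map_zero' := by ext; simp
  map_add' a b := by ext; simp
  map_mul' a b := by ext; simp
  map_star' a := by
    rw [ContinuousLinearMap.star_eq_adjoint, ContinuousLinearMap.eq_adjoint_iff]
    intro x y
    change ⟪ρ.σ (star a) x, (y : H)⟫_ℂ = ⟪(x : H), ρ.σ a y⟫_ℂ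
    rw [map_star, ContinuousLinearMap.star_eq_adjoint, ContinuousLinearMap.adjoint_inner_left]

lemma restrictσ_coe (a : A) (x : K) : (restrictσ hK a x : H) = ρ.σ a x := rfl

lemma restrictσ_nondegenerate : Nondegenerate (restrictσ hK) := by
  have hsurj : Function.Surjective K.orthogonalProjectionOnto := fun x =>
    ⟨x, K.orthogonalProjectionOnto_mem_subspace_eq_self x⟩
  refine (hsurj.denseRange.dense_image K.orthogonalProjectionOnto.continuous
    ρ.nondegenerate).mono ?_
  rintro _ ⟨g, hg, rfl⟩
  change g ∈ (Submodule.span ℂ {g : K | ∃ a h, restrictσ hK a h = g}).comap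
    K.orthogonalProjectionOnto.toLinearMap
  refine Submodule.span_le.mpr ?_ hg
  rintro _ ⟨a, h, rfl⟩
  refine Submodule.subset_span ⟨a, K.orthogonalProjectionOnto h, ?_⟩
  have h1 : ρ.σ a h = (restrictσ hK a (K.orthogonalProjectionOnto h) : H) +
      ρ.σ a (h - K.orthogonalProjectionOnto h) := by
    rw [restrictσ_coe, ← map_add, add_sub_cancel]
  have h2 : h - (K.orthogonalProjectionOnto h : H) ∈ Kᗮ := K.sub_starProjection_mem_orthogonal h
  change _ = K.orthogonalProjectionOnto (ρ.σ a h)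
  rw [h1, map_add, Submodule.orthogonalProjectionOnto_mem_subspace_eq_self,
    Submodule.orthogonalProjectionOnto_eq_zero_iff.mpr
      (hK.σ_mem_orthogonal a _ h2), add_zero]

/-- The restriction of `T⁽ⁱ⁾` to a reducing subspace. -/
def restrictT (i : Fin k) : IsometricMap (E (gen i)) (restrictσ hK) where
  T :=
    { toFun := fun ξ => ((ρ.T i).T ξ).restrict (hK.T_mem i ξ)
      map_add' := fun ξ η => by ext; simp
      map_smul' := fun c ξ => by ext; simp }
  map_lact a ξ := by ext x; simp [IsometricMap.map_lact, restrictσ_coe]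
  map_ract ξ a := by ext x; simp [IsometricMap.map_ract, restrictσ_coe]
  isometric ξ η := by
    ext x : 1
    refine ext_inner_left ℂ fun y => ?_
    rw [ContinuousLinearMap.comp_apply, ContinuousLinearMap.adjoint_inner_right]
    exact (ρ.T i).inner_T ξ η y x

lemma restrictT_coe (i : Fin k) (ξ : E (gen i)) (x : K) :
    ((restrictT hK i).T ξ x : H) = (ρ.T i).T ξ x := rfl

/-- The isometry `F ⊗ K → F ⊗ H` induced by the inclusion `K → H`. -/
def inclTensor (F : Type*) [NormedAddCommGroup F] [NormedSpace ℂ F] [SMul Aᵐᵒᵖ F]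
    [CStarCorrespondence A F] : Tensor F (restrictσ hK) →L[ℂ] Tensor F ρ.σ :=
  Tensor.map F (restrictσ hK) ρ.σ K.subtypeL

lemma inclTensor_tmul {F : Type*} [NormedAddCommGroup F] [NormedSpace ℂ F] [SMul Aᵐᵒᵖ F]
    [CStarCorrespondence A F] (ξ : F) (x : K) :
    inclTensor hK F (Tensor.tmul _ ξ x) = Tensor.tmul _ ξ (x : H) :=
  Tensor.map_tmul (restrictσ hK) ρ.σ K.subtypeL (fun _ _ => rfl) ξ x

lemma inclTensor_left {F : Type*} [NormedAddCommGroup F] [NormedSpace ℂ F] [SMul Aᵐᵒᵖ F]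
    [CStarCorrespondence A F] (a : A) (x : Tensor F (restrictσ hK)) :
    inclTensor hK F (Tensor.left F _ a x) = Tensor.left F ρ.σ a (inclTensor hK F x) := by
  have : inclTensor hK F ∘L Tensor.left F _ a = Tensor.left F ρ.σ a ∘L inclTensor hK F :=
    Tensor.ext _ fun ξ x => by simp [Tensor.left_tmul, inclTensor_tmul]
  exact congrArg (fun f => f x) this

lemma tilde_inclTensor (i : Fin k) (x : Tensor (E (gen i)) (restrictσ hK)) :
    (ρ.T i).tilde (inclTensor hK _ x) = (restrictT hK i).tilde x := by
  have : (ρ.T i).tilde ∘L inclTensor hK _ = K.subtypeL ∘L (restrictT hK i).tilde :=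
    Tensor.ext _ fun ξ x => by
      simp [IsometricMap.tilde_tmul, inclTensor_tmul, restrictT_coe]
  exact congrArg (fun f => f x) this

/-- The map `F ⊗ (F' ⊗ K) → F ⊗ (F' ⊗ H)` induced by the inclusion `K → H`. -/
def inclTensor₂ (F F' : Type*) [NormedAddCommGroup F] [NormedSpace ℂ F] [SMul Aᵐᵒᵖ F]
    [CStarCorrespondence A F] [NormedAddCommGroup F'] [NormedSpace ℂ F'] [SMul Aᵐᵒᵖ F']
    [CStarCorrespondence A F'] :
    Tensor F (Tensor.left F' (restrictσ hK)) →L[ℂ] Tensor F (Tensor.left F' ρ.σ) :=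
  Tensor.map F _ _ (inclTensor hK F')

lemma inclTensor₂_tmul {F F' : Type*} [NormedAddCommGroup F] [NormedSpace ℂ F] [SMul Aᵐᵒᵖ F]
    [CStarCorrespondence A F] [NormedAddCommGroup F'] [NormedSpace ℂ F'] [SMul Aᵐᵒᵖ F']
    [CStarCorrespondence A F'] (ξ : F) (x : Tensor F' (restrictσ hK)) :
    inclTensor₂ hK F F' (Tensor.tmul _ ξ x) = Tensor.tmul _ ξ (inclTensor hK F' x) :=
  Tensor.map_tmul _ _ _ (inclTensor_left hK) ξ x

lemma inclTensor_creation {m n p : Fin k → ℕ} (h : m + n = p) (ξ : E m)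
    (x : Tensor (E n) (restrictσ hK)) :
    inclTensor hK (E p) (𝓔.creation _ h ξ x) = 𝓔.creation ρ.σ h ξ (inclTensor hK (E n) x) := by
  have : inclTensor hK (E p) ∘L 𝓔.creation _ h ξ =
      𝓔.creation ρ.σ h ξ ∘L inclTensor hK (E n) :=
    Tensor.ext _ fun η x => by simp [ProductSystem.creation_tmul, inclTensor_tmul]
  exact congrArg (fun f => f x) this

lemma inclTensor_assoc {m n p : Fin k → ℕ} (h : m + n = p)
    (x : Tensor (E m) (Tensor.left (E n) (restrictσ hK))) :
    inclTensor hK (E p) (𝓔.assoc _ h x) = 𝓔.assoc ρ.σ h (inclTensor₂ hK (E m) (E n) x) := by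
  have : inclTensor hK (E p) ∘L
        (𝓔.assoc (restrictσ hK) h).toLinearIsometry.toContinuousLinearMap =
      (𝓔.assoc ρ.σ h).toLinearIsometry.toContinuousLinearMap ∘L inclTensor₂ hK (E m) (E n) :=
    Tensor.ext _ fun ξ x => by
      change inclTensor hK (E p) (𝓔.assoc _ h (Tensor.tmul _ ξ x)) =
        𝓔.assoc ρ.σ h (inclTensor₂ hK (E m) (E n) (Tensor.tmul _ ξ x))
      rw [inclTensor₂_tmul, ProductSystem.assoc_tmul, ProductSystem.assoc_tmul,
        inclTensor_creation]
  exact congrArg (fun f => f x) this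

lemma inclTensor₂_flipL (i j : Fin k)
    (x : Tensor (E (gen i)) (Tensor.left (E (gen j)) (restrictσ hK))) :
    inclTensor₂ hK _ _ (𝓔.flipL _ i j x) = 𝓔.flipL ρ.σ i j (inclTensor₂ hK _ _ x) := by
  change _ = (𝓔.assoc ρ.σ (add_comm (gen j) (gen i))).symm (𝓔.assoc ρ.σ rfl (inclTensor₂ hK _ _ x))
  rw [LinearIsometryEquiv.eq_symm_apply, ← inclTensor_assoc, ← inclTensor_assoc]
  congr 1
  exact LinearIsometryEquiv.apply_symm_apply _ _

lemma tilde_map_tilde_inclTensor₂ (i j : Fin k)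
    (x : Tensor (E (gen i)) (Tensor.left (E (gen j)) (restrictσ hK))) :
    (ρ.T i).tilde (Tensor.map (E (gen i)) (Tensor.left (E (gen j)) ρ.σ) ρ.σ (ρ.T j).tilde
        (inclTensor₂ hK _ _ x)) =
      (restrictT hK i).tilde (Tensor.map (E (gen i)) (Tensor.left (E (gen j)) (restrictσ hK))
        (restrictσ hK) (restrictT hK j).tilde x) := by
  rw [← tilde_inclTensor]
  congr 1
  have : Tensor.map (E (gen i)) (Tensor.left (E (gen j)) ρ.σ) ρ.σ (ρ.T j).tilde ∘L
      inclTensor₂ hK _ _ = inclTensor hK _ ∘L Tensor.map (E (gen i))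
        (Tensor.left (E (gen j)) (restrictσ hK)) (restrictσ hK) (restrictT hK j).tilde :=
    Tensor.ext _ fun ξ x => by
      rw [ContinuousLinearMap.comp_apply, ContinuousLinearMap.comp_apply, inclTensor₂_tmul,
        Tensor.map_tmul _ _ _ (IsometricMap.tilde_left _),
        Tensor.map_tmul _ _ _ (IsometricMap.tilde_left _), inclTensor_tmul, tilde_inclTensor]
  exact congrArg (fun f => f x) this

lemma restrict_comm (i j : Fin k) :
    (restrictT hK i).tilde ∘L Tensor.map (E (gen i)) (Tensor.left (E (gen j)) (restrictσ hK))
        (restrictσ hK) (restrictT hK j).tilde =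
      (restrictT hK j).tilde ∘L Tensor.map (E (gen j)) (Tensor.left (E (gen i)) (restrictσ hK))
        (restrictσ hK) (restrictT hK i).tilde ∘L 𝓔.flipL (restrictσ hK) i j := by
  ext x
  have h := congrArg (fun f => f (inclTensor₂ hK _ _ x)) (ρ.comm i j)
  simp only [ContinuousLinearMap.comp_apply, ← inclTensor₂_flipL,
    tilde_map_tilde_inclTensor₂] at h
  simpa using h

/-- The summand of the representation on a reducing subspace. -/
def restrict : IsometricRep 𝓔 K where
  σ := restrictσ hK
  nondegenerate := restrictσ_nondegenerate hK
  T := restrictT hK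
  comm i j := restrict_comm hK i j

end restrict

/-- `K` is a reducing subspace such that the corresponding summand is doubly commuting. -/
def IsDoublyCommutingSummand (K : Submodule ℂ H) : Prop :=
  ∃ hK : ρ.Reduces K, haveI := hK.completeSpace
    (restrict hK).DoublyCommuting

/-- `K` is a reducing subspace such that the `(σ, T⁽ⁱ⁾)|_K`, `i ∈ α`, form an induced
representation up to isomorphism and `(σ, T⁽ⁱ⁾)|_K` is fully coisometric for each `i ∉ α`. -/
def IsWoldSummand (α : Finset (Fin k)) (K : Submodule ℂ H) : Prop :=
  ∃ hK : ρ.Reduces K, haveI := hK.completeSpace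
    (restrict hK).IsInduced α ∧ ∀ i, i ∉ α → (restrict hK).FullyCoisometric i

end IsometricRep

end Representation

end Wold

end

/-!
Let `P i = T~⁽ⁱ⁾ T~⁽ⁱ⁾*` be the projection onto the closed linear span of the vectors `T⁽ⁱ⁾(ξ) h`.
The proof rests on a description of the two kinds of summands by these projections alone:

* a summand is doubly commuting iff `P j` commutes with `T⁽ⁱ⁾(ξ)` on it for all `i ≠ j`
  (`doublyCommuting_iff`; both sides of the defining relation are compared after applying the
  injective operator `T~⁽ʲ⁾`);
* a reducing subspace `K` is a Wold summand of type `α` iff it is doubly commuting, `P i` is the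
  identity on it for `i ∉ α`, and it is generated under the `T⁽ⁱ⁾(ξ)`, `i ∈ α`, by its wandering
  vectors, those killed by all `P i`, `i ∈ α` (`WoldOn`, `isWoldSummand_iff`).

In the second description, an induced representation is doubly commuting since `P j` is the
projection onto the summands `E n ⊗ K` of the Fock space with `n_j ≠ 0`; an index `i ∉ α` causes no
trouble because a unitary `T~⁽ⁱ⁾` doubly commutes with every `T~⁽ʲ⁾` (`proj_T_of_coisometric`).
Conversely the `T⁽ⁱ⁾` extend to all fibres (`fibre`), and for the wandering subspace `W` the
isometries `E n ⊗ W → H`, `η ⊗ v ↦ T(η) v`, have pairwise orthogonal ranges that together span a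
dense subspace of `H`, which gives the unitary from the Fock space (`WoldOn.isHilbertSum`).

The conditions of `WoldOn` pass to closed linear spans of families of subspaces, so there is a
largest Wold summand of each type (`woldPart`), and the sum of these is doubly commuting. If
`i ∈ α \ β`, then a summand of type `β` lies in the range of `P i` and is therefore orthogonal to
the wandering vectors for `α`, hence, being reducing, to the whole summand of type `α`.

It remains to see that a doubly commuting summand `K` lies in the sum. For this it is enough that
each nonzero `K` contains a nonzero Wold summand (`exists_woldOn`), since this can be applied to the
orthogonal complement in `K` of all Wold summands inside `K`. Choose `α` maximal such that `K`
contains a nonzero wandering vector for `α`. For `i ∉ α` the complement `v - P i v` of a wandering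
vector `v` for `α` is wandering for `α ∪ {i}`, hence zero; so `P i` is the identity on the wandering
vectors, and these generate a summand of type `α` (`WoldOn.generated`).
-/

noncomputable section

namespace Wold

universe w

open scoped TensorProduct InnerProductSpace

set_option linter.unusedSectionVars false

/-! ### Density and elementary tensors -/

section Tensor

variable {A F H : Type*} [NonUnitalCStarAlgebra A] [PartialOrder A] [StarOrderedRing A]
  [NormedAddCommGroup F] [NormedSpace ℂ F] [SMul Aᵐᵒᵖ F] [CStarCorrespondence A F]
  [NormedAddCommGroup H] [InnerProductSpace ℂ H] [CompleteSpace H]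

namespace Tensor

variable (σ : A →⋆ₙₐ[ℂ] (H →L[ℂ] H))

lemma mem_of_tmul_mem {M : Submodule ℂ (Tensor F σ)} (hM : IsClosed (M : Set (Tensor F σ)))
    (h : ∀ ξ v, tmul σ ξ v ∈ M) (x : Tensor F σ) : x ∈ M := by
  have hle : LinearMap.range (ofAlg (F := F) σ) ≤ M := by
    rintro _ ⟨y, rfl⟩
    induction y with
    | zero => simp
    | add y z hy hz => rw [map_add]; exact add_mem hy hz
    | tmul ξ v => exact h ξ v
  exact hM.closure_subset_iff.mpr (fun z hz => hle hz) (denseRange_ofAlg σ x)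

/-- The bounded operator `v ↦ ξ ⊗ v`. -/
def tmulL (ξ : F) : H →L[ℂ] Tensor F σ := (mk F σ ξ).mkContinuous ‖ξ‖ (norm_tmul_le σ ξ)

@[simp] lemma tmulL_apply (ξ : F) (v : H) : tmulL σ ξ v = tmul σ ξ v := rfl

/-- The bounded operator `ξ ↦ ξ ⊗ v`. -/
def tmulR (F : Type*) [NormedAddCommGroup F] [NormedSpace ℂ F] [SMul Aᵐᵒᵖ F]
    [CStarCorrespondence A F] (v : H) : F →L[ℂ] Tensor F σ :=
  ((mk F σ).flip v).mkContinuous ‖v‖ fun ξ => (norm_tmul_le σ ξ v).trans_eq (mul_comm _ _)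

@[simp] lemma tmulR_apply (ξ : F) (v : H) : tmulR σ F v ξ = tmul σ ξ v := rfl

lemma tmul_ract (ξ : F) (a : A) (v : H) : tmul σ (ract ξ a) v = tmul σ ξ (σ a v) := by
  refine ext_inner_left ℂ fun y => ?_
  have : innerSL ℂ (tmul σ (ract ξ a) v) = innerSL ℂ (tmul σ ξ (σ a v)) := ext σ fun η g => by
    rw [innerSL_apply_apply, innerSL_apply_apply, inner_tmul, inner_tmul, ip_ract_left, map_mul,
      map_star, ContinuousLinearMap.star_eq_adjoint, _root_.mul_apply_eq_comp,
      ContinuousLinearMap.adjoint_inner_right]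
  have h := congrArg (fun f => starRingEnd ℂ (f y)) this
  simpa using h

end Tensor

end Tensor

section ProductSystem

variable {A : Type*} [NonUnitalCStarAlgebra A] [PartialOrder A] [StarOrderedRing A]
  {k : ℕ} {E : (Fin k → ℕ) → Type*} [∀ n, NormedAddCommGroup (E n)] [∀ n, NormedSpace ℂ (E n)]
  [∀ n, SMul Aᵐᵒᵖ (E n)] [∀ n, CStarCorrespondence A (E n)] (𝓔 : ProductSystem A E)
  {H : Type*} [NormedAddCommGroup H] [InnerProductSpace ℂ H] [CompleteSpace H]
  (σ : A →⋆ₙₐ[ℂ] (H →L[ℂ] H)) {m n p : Fin k → ℕ}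

namespace ProductSystem

lemma mem_of_mul_mem (h : m + n = p) {M : Submodule ℂ (E p)} (hM : IsClosed (M : Set (E p)))
    (hmul : ∀ ξ η, 𝓔.mul h ξ η ∈ M) (ζ : E p) : ζ ∈ M := by
  have hle : Submodule.span ℂ {ζ : E p | ∃ ξ η, 𝓔.mul h ξ η = ζ} ≤ M := by
    rw [Submodule.span_le]
    rintro _ ⟨ξ, η, rfl⟩
    exact hmul ξ η
  exact hM.closure_subset_iff.mpr (fun z hz => hle hz) (𝓔.dense_mul h ζ)

lemma mul_ext {X : Type*} [NormedAddCommGroup X] [NormedSpace ℂ X] (h : m + n = p)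
    {f g : E p →L[ℂ] X} (hfg : ∀ ξ η, f (𝓔.mul h ξ η) = g (𝓔.mul h ξ η)) : f = g := by
  ext ζ
  exact 𝓔.mem_of_mul_mem h (M := LinearMap.eqLocus f.toLinearMap g.toLinearMap)
    (isClosed_eq f.continuous g.continuous) hfg ζ

lemma mem_of_creation_mem (h : m + n = p) {M : Submodule ℂ (Tensor (E p) σ)}
    (hM : IsClosed (M : Set (Tensor (E p) σ))) (hc : ∀ ξ x, 𝓔.creation σ h ξ x ∈ M)
    (x : Tensor (E p) σ) : x ∈ M := by
  refine Tensor.mem_of_tmul_mem σ hM (fun ζ v => ?_) x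
  refine 𝓔.mem_of_mul_mem h (M := M.comap (Tensor.tmulR σ (E p) v).toLinearMap)
    (hM.preimage (Tensor.tmulR σ (E p) v).continuous) (fun ξ η => ?_) ζ
  have := hc ξ (Tensor.tmul σ η v)
  rwa [creation_tmul] at this

lemma creation_ext {X : Type*} [NormedAddCommGroup X] [NormedSpace ℂ X] (h : m + n = p)
    {f g : Tensor (E p) σ →L[ℂ] X}
    (hfg : ∀ ξ x, f (𝓔.creation σ h ξ x) = g (𝓔.creation σ h ξ x)) : f = g := by
  ext x
  exact 𝓔.mem_of_creation_mem σ h (M := LinearMap.eqLocus f.toLinearMap g.toLinearMap)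
    (isClosed_eq f.continuous g.continuous) hfg x

lemma assoc_symm_creation (h : m + n = p) (ξ : E m) (x : Tensor (E n) σ) :
    (𝓔.assoc σ h).symm (𝓔.creation σ h ξ x) = Tensor.tmul _ ξ x := by
  rw [LinearIsometryEquiv.symm_apply_eq, assoc_tmul]

lemma left_creation (h : m + n = p) (a : A) (ξ : E m) (x : Tensor (E n) σ) :
    Tensor.left (E p) σ a (𝓔.creation σ h ξ x) = 𝓔.creation σ h (lact a ξ) x := by
  have : Tensor.left (E p) σ a ∘L 𝓔.creation σ h ξ = 𝓔.creation σ h (lact a ξ) :=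
    Tensor.ext σ fun η v => by simp [creation_tmul, Tensor.left_tmul, 𝓔.lact_mul]
  exact congrArg (fun f => f x) this

lemma creation_creation {q mn np : Fin k → ℕ} (h₁ : m + n = mn) (h₂ : mn + p = q)
    (h₃ : n + p = np) (h₄ : m + np = q) (ξ : E m) (η : E n) (x : Tensor (E p) σ) :
    𝓔.creation σ h₄ ξ (𝓔.creation σ h₃ η x) = 𝓔.creation σ h₂ (𝓔.mul h₁ ξ η) x := by
  have : 𝓔.creation σ h₄ ξ ∘L 𝓔.creation σ h₃ η = 𝓔.creation σ h₂ (𝓔.mul h₁ ξ η) :=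
    Tensor.ext σ fun ζ v => by
      simp only [ContinuousLinearMap.comp_apply, creation_tmul, 𝓔.mul_assoc h₁ h₂ h₃ h₄]
  exact congrArg (fun f => f x) this

/-- The operator `ζ ↦ (T_ζ ⊗ I) x`. -/
def creationR (h : m + n = p) (x : Tensor (E n) σ) : E m →L[ℂ] Tensor (E p) σ :=
  (𝓔.assoc σ h).toLinearIsometry.toContinuousLinearMap ∘L Tensor.tmulR _ (E m) x

lemma creationR_apply (h : m + n = p) (x : Tensor (E n) σ) (ζ : E m) :
    𝓔.creationR σ h x ζ = 𝓔.creation σ h ζ x := 𝓔.assoc_tmul σ h ζ x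

lemma eq_zero_of_ip_self {F : Type*} [NormedAddCommGroup F] [NormedSpace ℂ F] [SMul Aᵐᵒᵖ F]
    [CStarCorrespondence A F] {x : F} (h : ip A x x = 0) : x = 0 :=
  CStarModule.inner_self.mp (MulOpposite.unop_injective h : (inner Aᵐᵒᵖ x x : Aᵐᵒᵖ) = 0)

lemma ip_sub_right {F : Type*} [NormedAddCommGroup F] [NormedSpace ℂ F] [SMul Aᵐᵒᵖ F]
    [CStarCorrespondence A F] (x y z : F) : ip A x (y - z) = ip A x y - ip A x z := by
  simp [ip]

lemma ract_unit (a b : A) : ract (𝓔.unit a) b = 𝓔.unit (a * b) := by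
  rw [← sub_eq_zero]
  apply eq_zero_of_ip_self (A := A)
  obtain ⟨c, hc⟩ := 𝓔.unit.surjective (ract (𝓔.unit a) b - 𝓔.unit (a * b))
  nth_rewrite 1 [← hc]
  rw [ip_sub_right, ip_ract_right, 𝓔.ip_unit, 𝓔.ip_unit, _root_.mul_assoc, sub_self]

lemma lact_unit (a b : A) : lact a (𝓔.unit b) = 𝓔.unit (a * b) := by
  rw [← 𝓔.unit_mul (add_zero 0), 𝓔.mul_unit, ract_unit]

end ProductSystem

end ProductSystem

/-! ### Isometric maps, their range projections and products -/

namespace IsometricMap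

section

variable {A F H : Type*} [NonUnitalCStarAlgebra A] [PartialOrder A] [StarOrderedRing A]
  [NormedAddCommGroup F] [NormedSpace ℂ F] [SMul Aᵐᵒᵖ F] [CStarCorrespondence A F]
  [NormedAddCommGroup H] [InnerProductSpace ℂ H] [CompleteSpace H]
  {σ : A →⋆ₙₐ[ℂ] (H →L[ℂ] H)}

/-- The isometric map `ξ ↦ V (ξ ⊗ ·)` of an isometry `V` that intertwines the actions of `A`. -/
def ofIsometry (V : Tensor F σ →ₗᵢ[ℂ] H)
    (hV : ∀ a x, V (Tensor.left F σ a x) = σ a (V x)) : IsometricMap F σ where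
  T :=
    { toFun := fun ξ => V.toContinuousLinearMap ∘L Tensor.tmulL σ ξ
      map_add' := fun ξ η => by ext; simp [Tensor.tmul_add]
      map_smul' := fun c ξ => by ext; simp [Tensor.tmul_smul] }
  map_lact a ξ := by ext v; simp [← hV, Tensor.left_tmul]
  map_ract ξ a := by ext v; simp [Tensor.tmul_ract]
  isometric ξ η := by
    ext v
    refine ext_inner_left ℂ fun w => ?_
    rw [ContinuousLinearMap.comp_apply, ContinuousLinearMap.adjoint_inner_right]
    simp [Tensor.inner_tmul]

lemma ofIsometry_tilde (V : Tensor F σ →ₗᵢ[ℂ] H)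
    (hV : ∀ a x, V (Tensor.left F σ a x) = σ a (V x)) (x : Tensor F σ) :
    (ofIsometry V hV).tilde x = V x := by
  have : (ofIsometry V hV).tilde = V.toContinuousLinearMap :=
    Tensor.ext σ fun ξ v => by rw [tilde_tmul]; rfl
  rw [this]; rfl

variable (τ : IsometricMap F σ)

lemma inner_tilde (x y : Tensor F σ) : ⟪τ.tilde x, τ.tilde y⟫_ℂ = ⟪x, y⟫_ℂ :=
  τ.tildeIsometry.inner_map_map x y

lemma tilde_injective : Function.Injective τ.tilde := τ.tildeIsometry.injective

lemma adjoint_tilde_tilde (x : Tensor F σ) : ContinuousLinearMap.adjoint τ.tilde (τ.tilde x) = x :=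
  ext_inner_left ℂ fun y => by rw [ContinuousLinearMap.adjoint_inner_right, inner_tilde]

/-- The bounded operator `ξ ↦ T(ξ) v`. -/
def applyL (v : H) : F →L[ℂ] H := τ.tilde ∘L Tensor.tmulR σ F v

@[simp] lemma applyL_apply (v : H) (ξ : F) : τ.applyL v ξ = τ.T ξ v := τ.tilde_tmul ξ v

lemma σ_T (a : A) (ξ : F) (v : H) : σ a (τ.T ξ v) = τ.T (lact a ξ) v := by
  rw [map_lact]; rfl

lemma adjoint_T_T (ξ η : F) (v : H) :
    ContinuousLinearMap.adjoint (τ.T ξ) (τ.T η v) = σ (ip A ξ η) v :=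
  congrArg (fun f => f v) (τ.isometric ξ η)

lemma inner_σ (a : A) (v w : H) : ⟪σ a v, w⟫_ℂ = ⟪v, σ (star a) w⟫_ℂ := by
  rw [map_star, ContinuousLinearMap.star_eq_adjoint, ContinuousLinearMap.adjoint_inner_right]

lemma adjoint_tilde_σ (a : A) (v : H) :
    ContinuousLinearMap.adjoint τ.tilde (σ a v) =
      Tensor.left F σ a (ContinuousLinearMap.adjoint τ.tilde v) := by
  refine ext_inner_left ℂ fun y => ?_
  have h : ∀ z, ⟪y, Tensor.left F σ a z⟫_ℂ = ⟪Tensor.left F σ (star a) y, z⟫_ℂ := fun z => by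
    rw [map_star, ContinuousLinearMap.star_eq_adjoint, ContinuousLinearMap.adjoint_inner_left]
  rw [h, ContinuousLinearMap.adjoint_inner_right, ContinuousLinearMap.adjoint_inner_right,
    tilde_left, inner_σ, star_star]

/-- The closed linear span of the vectors `T(ξ) v`, `v ∈ M`. -/
def image (M : Submodule ℂ H) : Submodule ℂ H :=
  (Submodule.span ℂ {w : H | ∃ ξ, ∃ v ∈ M, τ.T ξ v = w}).topologicalClosure

lemma isClosed_image (M : Submodule ℂ H) : IsClosed (τ.image M : Set H) :=
  Submodule.isClosed_topologicalClosure _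

lemma T_mem_image {M : Submodule ℂ H} (ξ : F) {v : H} (hv : v ∈ M) : τ.T ξ v ∈ τ.image M :=
  Submodule.le_topologicalClosure _ (Submodule.subset_span ⟨ξ, v, hv, rfl⟩)

lemma image_le {M N : Submodule ℂ H} (hN : IsClosed (N : Set H))
    (h : ∀ ξ, ∀ v ∈ M, τ.T ξ v ∈ N) : τ.image M ≤ N := by
  refine Submodule.topologicalClosure_minimal _ (Submodule.span_le.mpr ?_) hN
  rintro _ ⟨ξ, v, hv, rfl⟩
  exact h ξ v hv

lemma image_mono {M N : Submodule ℂ H} (h : M ≤ N) : τ.image M ≤ τ.image N :=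
  τ.image_le (τ.isClosed_image N) fun ξ _ hv => τ.T_mem_image ξ (h hv)

/-- The range projection `T~ T~*`. -/
def proj : H →L[ℂ] H := τ.tilde ∘L ContinuousLinearMap.adjoint τ.tilde

lemma proj_apply (v : H) : τ.proj v = τ.tilde (ContinuousLinearMap.adjoint τ.tilde v) := rfl

lemma inner_proj (v w : H) : ⟪τ.proj v, w⟫_ℂ = ⟪v, τ.proj w⟫_ℂ := by
  rw [proj_apply, proj_apply, ← ContinuousLinearMap.adjoint_inner_left τ.tilde,
    ContinuousLinearMap.adjoint_inner_right]

lemma proj_tilde (x : Tensor F σ) : τ.proj (τ.tilde x) = τ.tilde x := by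
  rw [proj_apply, adjoint_tilde_tilde]

lemma proj_proj (v : H) : τ.proj (τ.proj v) = τ.proj v := τ.proj_tilde _

lemma proj_T (ξ : F) (v : H) : τ.proj (τ.T ξ v) = τ.T ξ v := by
  rw [← tilde_tmul, proj_tilde]

lemma proj_σ (a : A) (v : H) : τ.proj (σ a v) = σ a (τ.proj v) := by
  rw [proj_apply, adjoint_tilde_σ, tilde_left, proj_apply]

lemma adjoint_T_proj (ξ : F) (v : H) :
    ContinuousLinearMap.adjoint (τ.T ξ) (τ.proj v) = ContinuousLinearMap.adjoint (τ.T ξ) v := by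
  refine ext_inner_left ℂ fun y => ?_
  rw [ContinuousLinearMap.adjoint_inner_right, ContinuousLinearMap.adjoint_inner_right,
    ← inner_proj, proj_T]

lemma proj_eq_zero_iff {v : H} :
    τ.proj v = 0 ↔ ∀ ξ, ContinuousLinearMap.adjoint (τ.T ξ) v = 0 := by
  refine ⟨fun h ξ => by rw [← adjoint_T_proj, h, map_zero], fun h => ?_⟩
  suffices hz : ContinuousLinearMap.adjoint τ.tilde v = 0 by rw [proj_apply, hz, map_zero]
  refine ext_inner_right ℂ fun y => ?_
  rw [ContinuousLinearMap.adjoint_inner_left, inner_zero_left]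
  have : innerSL ℂ v ∘L τ.tilde = 0 := Tensor.ext σ fun ξ w => by
    simp [tilde_tmul, ← ContinuousLinearMap.adjoint_inner_left, h]
  exact congrArg (fun f => f y) this

lemma proj_mem_image (v : H) : τ.proj v ∈ τ.image ⊤ :=
  Tensor.mem_of_tmul_mem σ (M := (τ.image ⊤).comap τ.tilde.toLinearMap)
    ((τ.isClosed_image ⊤).preimage τ.tilde.continuous)
    (fun ξ w => by
      change τ.tilde _ ∈ τ.image ⊤
      rw [tilde_tmul]; exact τ.T_mem_image ξ Submodule.mem_top) _

lemma proj_of_mem_image {M : Submodule ℂ H} {v : H} (h : v ∈ τ.image M) : τ.proj v = v :=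
  τ.image_le (M := M) (N := LinearMap.eqLocus τ.proj.toLinearMap LinearMap.id)
    (isClosed_eq τ.proj.continuous continuous_id) (fun ξ w _ => τ.proj_T ξ w) h

lemma proj_eq_of_mem {M : Submodule ℂ H} {v w : H} (hw : w ∈ τ.image M)
    (h : ∀ ξ, ContinuousLinearMap.adjoint (τ.T ξ) (v - w) = 0) : τ.proj v = w := by
  have := τ.proj_eq_zero_iff.mpr h
  rwa [map_sub, τ.proj_of_mem_image hw, sub_eq_zero] at this

lemma adjoint_T_mem_of_mem_image {M : Submodule ℂ H} (hM : IsClosed (M : Set H))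
    (hσ : ∀ a, ∀ v ∈ M, σ a v ∈ M) (ξ : F) {v : H} (hv : v ∈ τ.image M) :
    ContinuousLinearMap.adjoint (τ.T ξ) v ∈ M :=
  τ.image_le (N := M.comap (ContinuousLinearMap.adjoint (τ.T ξ)).toLinearMap)
    (hM.preimage (ContinuousLinearMap.adjoint (τ.T ξ)).continuous)
    (fun η w hw => by
      change ContinuousLinearMap.adjoint (τ.T ξ) _ ∈ M
      rw [adjoint_T_T]; exact hσ _ _ hw) hv

end

section prod

variable {A : Type*} [NonUnitalCStarAlgebra A] [PartialOrder A] [StarOrderedRing A]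
  {k : ℕ} {E : (Fin k → ℕ) → Type*} [∀ n, NormedAddCommGroup (E n)] [∀ n, NormedSpace ℂ (E n)]
  [∀ n, SMul Aᵐᵒᵖ (E n)] [∀ n, CStarCorrespondence A (E n)] (𝓔 : ProductSystem A E)
  {H : Type*} [NormedAddCommGroup H] [InnerProductSpace ℂ H] [CompleteSpace H]
  {σ : A →⋆ₙₐ[ℂ] (H →L[ℂ] H)} {m n p : Fin k → ℕ}
  (τ : IsometricMap (E m) σ) (τ' : IsometricMap (E n) σ)

/-- The isometry `E m ⊗ (E n ⊗ H) → H`, `ξ ⊗ (η ⊗ v) ↦ T(ξ) T'(η) v`. -/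
def compIsometry : Tensor (E m) (Tensor.left (E n) σ) →ₗᵢ[ℂ] H :=
  Tensor.liftIsometry (Tensor.left (E n) σ)
    (((ContinuousLinearMap.coeLM ℂ).comp τ.T).compl₂ τ'.tilde.toLinearMap)
    (fun ξ η x y => by
      change ⟪τ.T ξ (τ'.tilde x), τ.T η (τ'.tilde y)⟫_ℂ = _
      rw [inner_T, ← tilde_left, inner_tilde])

lemma compIsometry_tmul (ξ : E m) (x : Tensor (E n) σ) :
    compIsometry τ τ' (Tensor.tmul _ ξ x) = τ.T ξ (τ'.tilde x) :=
  Tensor.liftIsometry_tmul _ _ _ ξ x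

lemma compIsometry_eq (x : Tensor (E m) (Tensor.left (E n) σ)) :
    compIsometry τ τ' x =
      τ.tilde (Tensor.map (E m) (Tensor.left (E n) σ) σ τ'.tilde x) := by
  have : (compIsometry τ τ').toContinuousLinearMap =
      τ.tilde ∘L Tensor.map (E m) (Tensor.left (E n) σ) σ τ'.tilde :=
    Tensor.ext _ fun ξ x => by
      change compIsometry τ τ' _ = τ.tilde (Tensor.map _ _ _ _ _)
      rw [compIsometry_tmul, Tensor.map_tmul _ _ _ τ'.tilde_left, tilde_tmul]
  exact congrArg (fun f => f x) this

/-- The isometric map of `E (m + n)` with `ξ η ↦ T(ξ) T'(η)`. -/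
def prod (h : m + n = p) : IsometricMap (E p) σ :=
  ofIsometry ((compIsometry τ τ').comp (𝓔.assoc σ h).symm.toLinearIsometry) fun a x => by
    have : ((compIsometry τ τ').comp
          (𝓔.assoc σ h).symm.toLinearIsometry).toContinuousLinearMap ∘L Tensor.left (E p) σ a =
        σ a ∘L ((compIsometry τ τ').comp
          (𝓔.assoc σ h).symm.toLinearIsometry).toContinuousLinearMap :=
      𝓔.creation_ext σ h fun ξ x => by
        change compIsometry τ τ' ((𝓔.assoc σ h).symm (Tensor.left (E p) σ a _)) =
          σ a (compIsometry τ τ' ((𝓔.assoc σ h).symm _))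
        rw [𝓔.left_creation, 𝓔.assoc_symm_creation, 𝓔.assoc_symm_creation, compIsometry_tmul,
          compIsometry_tmul, σ_T]
    exact congrArg (fun f => f x) this

lemma prod_tilde (h : m + n = p) (x : Tensor (E p) σ) :
    (prod 𝓔 τ τ' h).tilde x = compIsometry τ τ' ((𝓔.assoc σ h).symm x) :=
  ofIsometry_tilde _ _ x

lemma prod_tilde_creation (h : m + n = p) (ξ : E m) (x : Tensor (E n) σ) :
    (prod 𝓔 τ τ' h).tilde (𝓔.creation σ h ξ x) = τ.T ξ (τ'.tilde x) := by
  rw [prod_tilde, 𝓔.assoc_symm_creation, compIsometry_tmul]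

lemma prod_mul (h : m + n = p) (ξ : E m) (η : E n) (v : H) :
    (prod 𝓔 τ τ' h).T (𝓔.mul h ξ η) v = τ.T ξ (τ'.T η v) := by
  rw [← tilde_tmul, ← 𝓔.creation_tmul, prod_tilde_creation, tilde_tmul]

/-- The isometric map `a ↦ σ(a)` of the fibre `E 0 = A`. -/
def ofUnit (σ : A →⋆ₙₐ[ℂ] (H →L[ℂ] H)) : IsometricMap (E 0) σ where
  T :=
    { toFun := fun ξ => σ (𝓔.unit.symm ξ)
      map_add' := fun ξ η => by simp
      map_smul' := fun c ξ => by simp }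
  map_lact a ξ := by
    obtain ⟨b, rfl⟩ := 𝓔.unit.surjective ξ
    ext v
    simp [𝓔.lact_unit]
  map_ract ξ a := by
    obtain ⟨b, rfl⟩ := 𝓔.unit.surjective ξ
    ext v
    simp [𝓔.ract_unit]
  isometric ξ η := by
    obtain ⟨b, rfl⟩ := 𝓔.unit.surjective ξ
    obtain ⟨c, rfl⟩ := 𝓔.unit.surjective η
    ext v
    simp [𝓔.ip_unit, map_star, ContinuousLinearMap.star_eq_adjoint]

lemma ofUnit_T (a : A) (v : H) : (ofUnit 𝓔 σ).T (𝓔.unit a) v = σ a v := by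
  change σ (𝓔.unit.symm (𝓔.unit a)) v = _
  rw [LinearEquiv.symm_apply_apply]

end prod

end IsometricMap

namespace IsometricMap

variable {A F H : Type*} [NonUnitalCStarAlgebra A] [PartialOrder A] [StarOrderedRing A]
  [NormedAddCommGroup F] [NormedSpace ℂ F] [SMul Aᵐᵒᵖ F] [CStarCorrespondence A F]
  [NormedAddCommGroup H] [InnerProductSpace ℂ H] [CompleteSpace H]
  {σ : A →⋆ₙₐ[ℂ] (H →L[ℂ] H)} (τ : IsometricMap F σ)

/-- If `M` is invariant under `σ` and the adjoints `T(ξ)*`, then `T~* M` lies in `F ⊗ M`. -/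
lemma proj_mem_image_of_adjoint_mem {M : Submodule ℂ H} (hM : IsClosed (M : Set H))
    (hσ : ∀ a, ∀ v ∈ M, σ a v ∈ M)
    (hadj : ∀ ξ, ∀ v ∈ M, ContinuousLinearMap.adjoint (τ.T ξ) v ∈ M) {v : H} (hv : v ∈ M) :
    τ.proj v ∈ τ.image M := by
  have : CompleteSpace M := hM.completeSpace_coe
  have : CompleteSpace (τ.image M) := (τ.isClosed_image M).completeSpace_coe
  set w : H := (τ.image M).starProjection (τ.proj v) with hw
  have hwM : w ∈ τ.image M := Submodule.starProjection_apply_mem _ _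
  have hperp : τ.proj v - w ∈ (τ.image M)ᗮ := Submodule.sub_starProjection_mem_orthogonal _
  suffices h0 : τ.proj (τ.proj v - w) = 0 by
    rw [map_sub, proj_proj, τ.proj_of_mem_image hwM, sub_eq_zero] at h0
    rwa [h0]
  rw [proj_eq_zero_iff]
  intro ξ
  have h1 : ContinuousLinearMap.adjoint (τ.T ξ) (τ.proj v - w) ∈ M := by
    rw [map_sub, adjoint_T_proj]
    exact sub_mem (hadj ξ v hv) (τ.adjoint_T_mem_of_mem_image hM hσ ξ hwM)
  have h2 : ContinuousLinearMap.adjoint (τ.T ξ) (τ.proj v - w) ∈ Mᗮ := by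
    rw [Submodule.mem_orthogonal]
    intro g hg
    rw [ContinuousLinearMap.adjoint_inner_right]
    exact (Submodule.mem_orthogonal _ _).mp hperp _ (τ.T_mem_image ξ hg)
  exact (Submodule.disjoint_def.mp (Submodule.orthogonal_disjoint M)) _ h1 h2

end IsometricMap

section Representation

variable {A : Type*} [NonUnitalCStarAlgebra A] [PartialOrder A] [StarOrderedRing A]
  {k : ℕ} {E : (Fin k → ℕ) → Type*} [∀ n, NormedAddCommGroup (E n)] [∀ n, NormedSpace ℂ (E n)]
  [∀ n, SMul Aᵐᵒᵖ (E n)] [∀ n, CStarCorrespondence A (E n)]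
  {H : Type*} [NormedAddCommGroup H] [InnerProductSpace ℂ H] [CompleteSpace H]

namespace IsometricRep

variable {𝓔 : ProductSystem A E} (ρ : IsometricRep 𝓔 H)

/-! ### Double commutation through range projections -/

/-- The two factorizations of the fibre over `e_i + e_j` give the same operators. -/
lemma prod_comm (i j : Fin k) (ζ : E (gen i + gen j)) :
    ((ρ.T i).prod 𝓔 (ρ.T j) rfl).T ζ =
      ((ρ.T j).prod 𝓔 (ρ.T i) (add_comm (gen j) (gen i))).T ζ := by
  ext v
  rw [← IsometricMap.tilde_tmul, ← IsometricMap.tilde_tmul, IsometricMap.prod_tilde,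
    IsometricMap.prod_tilde, IsometricMap.compIsometry_eq, IsometricMap.compIsometry_eq]
  have h := congrArg (fun f => f ((𝓔.assoc ρ.σ rfl).symm (Tensor.tmul ρ.σ ζ v))) (ρ.comm i j)
  have hflip : 𝓔.flipL ρ.σ i j ((𝓔.assoc ρ.σ rfl).symm (Tensor.tmul ρ.σ ζ v)) =
      (𝓔.assoc ρ.σ (add_comm (gen j) (gen i))).symm (Tensor.tmul ρ.σ ζ v) := by
    change (𝓔.assoc ρ.σ _).symm (𝓔.assoc ρ.σ _ ((𝓔.assoc ρ.σ rfl).symm _)) = _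
    rw [LinearIsometryEquiv.apply_symm_apply]
  simpa only [ContinuousLinearMap.comp_apply, hflip] using h

/-- The vector `T⁽ⁱ⁾(ξ) T⁽ʲ⁾(η) h` is a limit of sums of vectors `T⁽ʲ⁾(η') T⁽ⁱ⁾(ξ') h`. -/
lemma T_T_mem {N : Submodule ℂ H} (hN : IsClosed (N : Set H)) (i j : Fin k) {v : H}
    (h : ∀ η ξ, (ρ.T j).T η ((ρ.T i).T ξ v) ∈ N) (ξ : E (gen i)) (η : E (gen j)) :
    (ρ.T i).T ξ ((ρ.T j).T η v) ∈ N := by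
  rw [← IsometricMap.prod_mul 𝓔 _ _ rfl, prod_comm, ← IsometricMap.applyL_apply]
  refine 𝓔.mem_of_mul_mem (add_comm (gen j) (gen i)) (M := N.comap
    (((ρ.T j).prod 𝓔 (ρ.T i) (add_comm (gen j) (gen i))).applyL v).toLinearMap)
    (hN.preimage (ContinuousLinearMap.continuous _)) (fun η ξ => ?_) _
  change ((ρ.T j).prod 𝓔 (ρ.T i) (add_comm (gen j) (gen i))).applyL v _ ∈ N
  rw [IsometricMap.applyL_apply, IsometricMap.prod_mul]
  exact h η ξ

/-- The range projection of `T~⁽ʲ⁾` commutes with the operators `T⁽ⁱ⁾(ξ)`, `i ≠ j`, on `K`. -/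
def CommutesOn (K : Submodule ℂ H) : Prop :=
  ∀ i j : Fin k, i ≠ j → ∀ ξ : E (gen i), ∀ v ∈ K,
    (ρ.T j).proj ((ρ.T i).T ξ v) = (ρ.T i).T ξ ((ρ.T j).proj v)

/-- Both sides of the relation of double commutation take values in the domain of the isometry
`T~⁽ʲ⁾`; composed with it they are `P_j T⁽ⁱ⁾(ξ)` and `T⁽ⁱ⁾(ξ) P_j`, with `P_j = T~⁽ʲ⁾ T~⁽ʲ⁾*`. -/
lemma doublyCommuting_iff : ρ.DoublyCommuting ↔ ρ.CommutesOn ⊤ := by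
  have key : ∀ (i j : Fin k) (ξ : E (gen i)) (v : H),
      (ρ.T j).tilde ((Tensor.map (E (gen j)) (Tensor.left (E (gen i)) ρ.σ) ρ.σ (ρ.T i).tilde ∘L
        𝓔.flipL ρ.σ i j ∘L Tensor.map (E (gen i)) ρ.σ (Tensor.left (E (gen j)) ρ.σ)
          (ContinuousLinearMap.adjoint (ρ.T j).tilde)) (Tensor.tmul ρ.σ ξ v)) =
        (ρ.T i).T ξ ((ρ.T j).proj v) := by
    intro i j ξ v
    rw [ContinuousLinearMap.comp_apply, ContinuousLinearMap.comp_apply,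
      Tensor.map_tmul _ _ _ (IsometricMap.adjoint_tilde_σ _)]
    have h := congrArg (fun f => f (Tensor.tmul (Tensor.left (E (gen j)) ρ.σ) ξ
      (ContinuousLinearMap.adjoint (ρ.T j).tilde v))) (ρ.comm i j)
    simp only [ContinuousLinearMap.comp_apply] at h
    rw [← h, Tensor.map_tmul _ _ _ (IsometricMap.tilde_left _), IsometricMap.tilde_tmul,
      IsometricMap.proj_apply]
  constructor
  · intro h i j hij ξ v _
    rw [← key, ← h i j hij, ContinuousLinearMap.comp_apply, IsometricMap.tilde_tmul,
      IsometricMap.proj_apply]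
  · intro h i j hij
    refine Tensor.ext _ fun ξ v => (ρ.T j).tilde_injective ?_
    rw [key, ← h i j hij ξ v trivial, ContinuousLinearMap.comp_apply, IsometricMap.tilde_tmul,
      IsometricMap.proj_apply]

lemma fullyCoisometric_iff (i : Fin k) :
    ρ.FullyCoisometric i ↔ ∀ v, (ρ.T i).proj v = v := by
  rw [FullyCoisometric, ContinuousLinearMap.ext_iff]
  rfl

/-! ### Reducing subspaces -/

variable {ρ}

lemma reduces_of_adjoint_mem {K : Submodule ℂ H} (hK : IsClosed (K : Set H))
    (hσ : ∀ a, ∀ v ∈ K, ρ.σ a v ∈ K) (hT : ∀ i ξ, ∀ v ∈ K, (ρ.T i).T ξ v ∈ K)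
    (hadj : ∀ i ξ, ∀ v ∈ K, ContinuousLinearMap.adjoint ((ρ.T i).T ξ) v ∈ K) : ρ.Reduces K where
  isClosed := hK
  σ_mem := hσ
  σ_mem_orthogonal a v hv := by
    rw [Submodule.mem_orthogonal] at hv ⊢
    intro u hu
    rw [← star_star a, ← IsometricMap.inner_σ]
    exact hv _ (hσ _ _ hu)
  T_mem := hT
  T_mem_orthogonal i ξ v hv := by
    rw [Submodule.mem_orthogonal] at hv ⊢
    intro u hu
    rw [← ContinuousLinearMap.adjoint_inner_left]
    exact hv _ (hadj i ξ _ hu)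

namespace Reduces

variable {K L : Submodule ℂ H}

lemma orthogonal_orthogonal (hK : ρ.Reduces K) : Kᗮᗮ = K := by
  have := hK.completeSpace
  exact Submodule.orthogonal_orthogonal K

lemma adjoint_T_mem (hK : ρ.Reduces K) (i : Fin k) (ξ : E (gen i)) {v : H} (hv : v ∈ K) :
    ContinuousLinearMap.adjoint ((ρ.T i).T ξ) v ∈ K := by
  rw [← hK.orthogonal_orthogonal, Submodule.mem_orthogonal]
  intro u hu
  rw [ContinuousLinearMap.adjoint_inner_right]
  exact (Submodule.mem_orthogonal' _ _).mp (hK.T_mem_orthogonal i ξ u hu) _ hv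

lemma orthogonal (hK : ρ.Reduces K) : ρ.Reduces Kᗮ where
  isClosed := K.isClosed_orthogonal
  σ_mem := hK.σ_mem_orthogonal
  σ_mem_orthogonal := by rw [hK.orthogonal_orthogonal]; exact hK.σ_mem
  T_mem := hK.T_mem_orthogonal
  T_mem_orthogonal := by rw [hK.orthogonal_orthogonal]; exact hK.T_mem

lemma inf (hK : ρ.Reduces K) (hL : ρ.Reduces L) : ρ.Reduces (K ⊓ L) :=
  reduces_of_adjoint_mem (hK.isClosed.inter hL.isClosed)
    (fun a v hv => ⟨hK.σ_mem a v hv.1, hL.σ_mem a v hv.2⟩)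
    (fun i ξ v hv => ⟨hK.T_mem i ξ v hv.1, hL.T_mem i ξ v hv.2⟩)
    (fun i ξ _ hv => ⟨hK.adjoint_T_mem i ξ hv.1, hL.adjoint_T_mem i ξ hv.2⟩)

lemma proj_mem_image (hK : ρ.Reduces K) (i : Fin k) {v : H} (hv : v ∈ K) :
    (ρ.T i).proj v ∈ (ρ.T i).image K :=
  (ρ.T i).proj_mem_image_of_adjoint_mem hK.isClosed hK.σ_mem
    (fun ξ _ hw => hK.adjoint_T_mem i ξ hw) hv

lemma proj_mem (hK : ρ.Reduces K) (i : Fin k) {v : H} (hv : v ∈ K) : (ρ.T i).proj v ∈ K :=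
  (ρ.T i).image_le hK.isClosed (hK.T_mem i) (hK.proj_mem_image i hv)

lemma adjoint_restrictT_coe (hK : ρ.Reduces K) [CompleteSpace K] (i : Fin k) (ξ : E (gen i))
    (v : K) : (ContinuousLinearMap.adjoint ((restrictT hK i).T ξ) v : H) =
      ContinuousLinearMap.adjoint ((ρ.T i).T ξ) v := by
  have : ContinuousLinearMap.adjoint ((restrictT hK i).T ξ) v =
      ⟨ContinuousLinearMap.adjoint ((ρ.T i).T ξ) v, hK.adjoint_T_mem i ξ v.2⟩ := by
    refine ext_inner_left ℂ fun w => ?_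
    rw [ContinuousLinearMap.adjoint_inner_right, Submodule.coe_inner, Submodule.coe_inner,
      restrictT_coe, ContinuousLinearMap.adjoint_inner_right]
  rw [this]

lemma image_restrictT_le (hK : ρ.Reduces K) [CompleteSpace K] (i : Fin k) {v : K}
    (hv : v ∈ (restrictT hK i).image ⊤) : (v : H) ∈ (ρ.T i).image K :=
  (restrictT hK i).image_le (N := ((ρ.T i).image K).comap K.subtype)
    (((ρ.T i).isClosed_image K).preimage continuous_subtype_val)
    (fun ξ w _ => (ρ.T i).T_mem_image ξ w.2) hv

lemma proj_restrictT_coe (hK : ρ.Reduces K) [CompleteSpace K] (i : Fin k) (v : K) :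
    ((restrictT hK i).proj v : H) = (ρ.T i).proj v := by
  refine ((ρ.T i).proj_eq_of_mem
    (hK.image_restrictT_le i ((restrictT hK i).proj_mem_image v)) fun ξ => ?_).symm
  rw [← Submodule.coe_sub, ← hK.adjoint_restrictT_coe, map_sub, IsometricMap.adjoint_T_proj,
    sub_self, Submodule.coe_zero]

end Reduces

lemma map_mem_closure_sSup {S : Set (Submodule ℂ H)} (f : H →L[ℂ] H)
    (hf : ∀ K ∈ S, ∀ v ∈ K, f v ∈ K) {v : H} (hv : v ∈ (sSup S).topologicalClosure) :
    f v ∈ (sSup S).topologicalClosure := by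
  have hle : (sSup S).topologicalClosure ≤ (sSup S).topologicalClosure.comap f.toLinearMap := by
    refine Submodule.topologicalClosure_minimal _ (sSup_le fun K hK v hv => ?_)
      ((Submodule.isClosed_topologicalClosure _).preimage f.continuous)
    exact Submodule.le_topologicalClosure _ (le_sSup hK (hf K hK v hv))
  exact hle hv

lemma Reduces.closure_sSup {S : Set (Submodule ℂ H)} (hS : ∀ K ∈ S, ρ.Reduces K) :
    ρ.Reduces (sSup S).topologicalClosure :=
  reduces_of_adjoint_mem (Submodule.isClosed_topologicalClosure _)
    (fun a _ => map_mem_closure_sSup (ρ.σ a) fun K hK => (hS K hK).σ_mem a)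
    (fun i ξ _ => map_mem_closure_sSup ((ρ.T i).T ξ) fun K hK => (hS K hK).T_mem i ξ)
    (fun i ξ _ => map_mem_closure_sSup _ fun K hK _ hv => (hS K hK).adjoint_T_mem i ξ hv)

/-! ### Subspaces generated by wandering vectors -/

variable (ρ)

/-- The vectors orthogonal to the ranges of `T~⁽ⁱ⁾`, `i ∈ α`. -/
def wandering (α : Finset (Fin k)) : Submodule ℂ H :=
  ⨅ i ∈ α, LinearMap.ker (ρ.T i).proj.toLinearMap

variable {ρ} in
lemma mem_wandering {α : Finset (Fin k)} {v : H} :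
    v ∈ ρ.wandering α ↔ ∀ i ∈ α, (ρ.T i).proj v = 0 := by
  simp [wandering, Submodule.mem_iInf]

lemma isClosed_wandering (α : Finset (Fin k)) : IsClosed (ρ.wandering α : Set H) := by
  have : (ρ.wandering α : Set H) = ⋂ i ∈ α, {v | (ρ.T i).proj v = 0} := by
    ext v
    simp [mem_wandering]
  rw [this]
  exact isClosed_biInter fun i _ => isClosed_eq (ρ.T i).proj.continuous continuous_const

lemma σ_mem_wandering {α : Finset (Fin k)} (a : A) {v : H} (hv : v ∈ ρ.wandering α) :
    ρ.σ a v ∈ ρ.wandering α := by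
  rw [mem_wandering] at hv ⊢
  intro i hi
  rw [IsometricMap.proj_σ, hv i hi, map_zero]

/-- The smallest closed subspace that contains `W` and is invariant under the `T⁽ⁱ⁾(ξ)`,
`i ∈ α`. -/
def generated (α : Finset (Fin k)) (W : Submodule ℂ H) : Submodule ℂ H :=
  sInf {M | W ≤ M ∧ IsClosed (M : Set H) ∧ ∀ i ∈ α, ∀ ξ, ∀ v ∈ M, (ρ.T i).T ξ v ∈ M}

variable {α : Finset (Fin k)} {W : Submodule ℂ H}

lemma le_generated : W ≤ ρ.generated α W := le_sInf fun _ hM => hM.1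

lemma isClosed_generated : IsClosed (ρ.generated α W : Set H) := by
  rw [generated, Submodule.coe_sInf]
  exact isClosed_biInter fun _ hM => hM.2.1

lemma T_mem_generated {i : Fin k} (hi : i ∈ α) (ξ : E (gen i)) {v : H}
    (hv : v ∈ ρ.generated α W) : (ρ.T i).T ξ v ∈ ρ.generated α W := by
  rw [generated, Submodule.mem_sInf] at hv ⊢
  exact fun M hM => hM.2.2 i hi ξ v (hv M hM)

lemma generated_le {M : Submodule ℂ H} (hW : W ≤ M) (hM : IsClosed (M : Set H))
    (hT : ∀ i ∈ α, ∀ ξ, ∀ v ∈ ρ.generated α W ⊓ M, (ρ.T i).T ξ v ∈ M) : ρ.generated α W ≤ M := by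
  have : ρ.generated α W ≤ ρ.generated α W ⊓ M :=
    sInf_le ⟨le_inf ρ.le_generated hW, ρ.isClosed_generated.inter hM,
      fun i hi ξ v hv => ⟨ρ.T_mem_generated hi ξ hv.1, hT i hi ξ v hv⟩⟩
  exact this.trans inf_le_right

lemma generated_mono {W' : Submodule ℂ H} (h : W ≤ W') : ρ.generated α W ≤ ρ.generated α W' :=
  ρ.generated_le (h.trans ρ.le_generated) ρ.isClosed_generated
    fun _ hi ξ _ hv => ρ.T_mem_generated hi ξ hv.2

/-- The intrinsic description of a Wold summand of type `α`: a reducing subspace, doubly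
commuting, fully coisometric outside `α` and generated by its wandering vectors for `α`. -/
structure WoldOn (α : Finset (Fin k)) (K : Submodule ℂ H) : Prop where
  reduces : ρ.Reduces K
  commutes : ρ.CommutesOn K
  proj_eq : ∀ i, i ∉ α → ∀ v ∈ K, (ρ.T i).proj v = v
  le_generated : K ≤ ρ.generated α (K ⊓ ρ.wandering α)

variable {ρ} {K L : Submodule ℂ H}

lemma CommutesOn.mono (hK : ρ.CommutesOn K) (h : L ≤ K) : ρ.CommutesOn L :=
  fun i j hij ξ v hv => hK i j hij ξ v (h hv)

lemma CommutesOn.closure_sSup {S : Set (Submodule ℂ H)} (hS : ∀ K ∈ S, ρ.CommutesOn K) :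
    ρ.CommutesOn (sSup S).topologicalClosure := by
  intro i j hij ξ v hv
  have hle : (sSup S).topologicalClosure ≤ LinearMap.eqLocus
      ((ρ.T j).proj ∘L (ρ.T i).T ξ).toLinearMap ((ρ.T i).T ξ ∘L (ρ.T j).proj).toLinearMap :=
    Submodule.topologicalClosure_minimal _
      (sSup_le fun K hK v hv => hS K hK i j hij ξ v hv)
      (isClosed_eq (ContinuousLinearMap.continuous _) (ContinuousLinearMap.continuous _))
  exact hle hv

lemma WoldOn.closure_sSup {S : Set (Submodule ℂ H)} (hS : ∀ K ∈ S, ρ.WoldOn α K) :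
    ρ.WoldOn α (sSup S).topologicalClosure where
  reduces := .closure_sSup fun K hK => (hS K hK).reduces
  commutes := .closure_sSup fun K hK => (hS K hK).commutes
  proj_eq i hi v hv := by
    have hle : (sSup S).topologicalClosure ≤ LinearMap.eqLocus
        (ρ.T i).proj.toLinearMap LinearMap.id :=
      Submodule.topologicalClosure_minimal _
        (sSup_le fun K hK v hv => (hS K hK).proj_eq i hi v hv)
        (isClosed_eq (ContinuousLinearMap.continuous _) continuous_id)
    exact hle hv
  le_generated := Submodule.topologicalClosure_minimal _
    (sSup_le fun K hK => (hS K hK).le_generated.trans (ρ.generated_mono (inf_le_inf_right _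
      ((le_sSup hK).trans (Submodule.le_topologicalClosure _))))) ρ.isClosed_generated

/-- If `i ∈ α \ β`, then a summand of type `β` lies in the range of `T~⁽ⁱ⁾`, to which the wandering
vectors of type `α` are orthogonal. -/
lemma WoldOn.isOrtho_of_mem {β : Finset (Fin k)} (hK : ρ.WoldOn α K) (hL : ρ.WoldOn β L)
    {i : Fin k} (hα : i ∈ α) (hβ : i ∉ β) : K ⟂ L := by
  refine hK.le_generated.trans (ρ.generated_le ?_ L.isClosed_orthogonal
    fun j _ ξ v hv => hL.reduces.T_mem_orthogonal j ξ v hv.2)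
  intro v hv
  rw [Submodule.mem_orthogonal]
  intro u hu
  rw [← hL.proj_eq i hβ u hu, IsometricMap.inner_proj, mem_wandering.mp hv.2 i hα, inner_zero_right]

lemma WoldOn.isOrtho {β : Finset (Fin k)} (hK : ρ.WoldOn α K) (hL : ρ.WoldOn β L)
    (h : α ≠ β) : K ⟂ L := by
  by_cases hαβ : α ⊆ β
  · obtain ⟨i, hβ, hα⟩ := Finset.not_subset.mp fun hβα => h (hαβ.antisymm hβα)
    exact (hL.isOrtho_of_mem hK hβ hα).symm
  · obtain ⟨i, hα, hβ⟩ := Finset.not_subset.mp hαβ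
    exact hK.isOrtho_of_mem hL hα hβ

/-! ### Doubly commuting summands -/

lemma CommutesOn.adjoint_T_proj (hK : ρ.Reduces K) (hc : ρ.CommutesOn K) {i j : Fin k}
    (hij : i ≠ j) (ξ : E (gen i)) {v : H} (hv : v ∈ K) :
    ContinuousLinearMap.adjoint ((ρ.T i).T ξ) ((ρ.T j).proj v) =
      (ρ.T j).proj (ContinuousLinearMap.adjoint ((ρ.T i).T ξ) v) := by
  rw [← sub_eq_zero]
  refine (Submodule.disjoint_def.mp (Submodule.orthogonal_disjoint K)) _
    (sub_mem (hK.adjoint_T_mem i ξ (hK.proj_mem j hv))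
      (hK.proj_mem j (hK.adjoint_T_mem i ξ hv))) ?_
  rw [Submodule.mem_orthogonal]
  intro u hu
  rw [inner_sub_right, ContinuousLinearMap.adjoint_inner_right, ← IsometricMap.inner_proj,
    ← IsometricMap.inner_proj, ContinuousLinearMap.adjoint_inner_right, hc i j hij ξ u hu, sub_self]

lemma CommutesOn.proj_proj (hK : ρ.Reduces K) (hc : ρ.CommutesOn K) {i j : Fin k}
    (hij : i ≠ j) {v : H} (hv : v ∈ K) :
    (ρ.T i).proj ((ρ.T j).proj v) = (ρ.T j).proj ((ρ.T i).proj v) := by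
  have himage : (ρ.T i).image K ≤ ((ρ.T i).image K).comap (ρ.T j).proj.toLinearMap :=
    (ρ.T i).image_le (((ρ.T i).isClosed_image K).preimage (ρ.T j).proj.continuous)
      fun ξ u hu => by
        change (ρ.T j).proj _ ∈ (ρ.T i).image K
        rw [hc i j hij ξ u hu]
        exact (ρ.T i).T_mem_image ξ (hK.proj_mem j hu)
  refine (ρ.T i).proj_eq_of_mem (himage (hK.proj_mem_image i hv)) fun ξ => ?_
  rw [← map_sub, hc.adjoint_T_proj hK hij ξ (sub_mem hv (hK.proj_mem i hv)), map_sub,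
    IsometricMap.adjoint_T_proj, sub_self, map_zero]

/-- If the wandering vectors `W = K ∩ wandering α` lie in the ranges of all `T~⁽ⁱ⁾`, `i ∉ α`, then
they generate a summand of type `α`. -/
lemma WoldOn.generated (hK : ρ.Reduces K) (hc : ρ.CommutesOn K)
    (hW : ∀ i, i ∉ α → ∀ v ∈ K ⊓ ρ.wandering α, (ρ.T i).proj v = v) :
    ρ.WoldOn α (ρ.generated α (K ⊓ ρ.wandering α)) := by
  set W := K ⊓ ρ.wandering α
  set M := ρ.generated α W
  have hWM : W ≤ M := ρ.le_generated
  have hMcl : IsClosed (M : Set H) := ρ.isClosed_generated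
  have hMK : M ≤ K := ρ.generated_le inf_le_left hK.isClosed
    fun i _ ξ v hv => hK.T_mem i ξ v hv.2
  have hWσ : ∀ a, ∀ v ∈ W, ρ.σ a v ∈ W := fun a v hv =>
    ⟨hK.σ_mem a v hv.1, ρ.σ_mem_wandering a hv.2⟩
  have hWT : ∀ i, i ∉ α → ∀ ξ, ∀ v ∈ W, (ρ.T i).T ξ v ∈ W := fun i hi ξ v hv =>
    ⟨hK.T_mem i ξ v hv.1, mem_wandering.mpr fun j hj => by
      rw [hc i j (ne_of_mem_of_not_mem hj hi).symm ξ v hv.1, mem_wandering.mp hv.2 j hj, map_zero]⟩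
  have hWadj : ∀ i, i ∉ α → ∀ ξ, ∀ v ∈ W,
      ContinuousLinearMap.adjoint ((ρ.T i).T ξ) v ∈ W := fun i hi ξ v hv =>
    ⟨hK.adjoint_T_mem i ξ hv.1, mem_wandering.mpr fun j hj => by
      rw [← hc.adjoint_T_proj hK (ne_of_mem_of_not_mem hj hi).symm ξ hv.1,
        mem_wandering.mp hv.2 j hj, map_zero]⟩
  have hσ : ∀ a, M ≤ M.comap (ρ.σ a).toLinearMap := fun a =>
    ρ.generated_le (fun v hv => hWM (hWσ a v hv)) (hMcl.preimage (ρ.σ a).continuous)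
      fun i hi ξ v hv => by
        change ρ.σ a _ ∈ M
        rw [IsometricMap.σ_T]
        exact ρ.T_mem_generated hi _ hv.1
  have hT : ∀ i ξ, ∀ v ∈ M, (ρ.T i).T ξ v ∈ M := by
    intro i ξ v hv
    by_cases hi : i ∈ α
    · exact ρ.T_mem_generated hi ξ hv
    have hle : M ≤ ⨅ ξ, M.comap ((ρ.T i).T ξ).toLinearMap := by
      refine ρ.generated_le (le_iInf fun ξ v hv => hWM (hWT i hi ξ v hv)) ?_ ?_
      · rw [Submodule.coe_iInf]
        exact isClosed_iInter fun ξ => hMcl.preimage ((ρ.T i).T ξ).continuous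
      · intro j hj η v hv
        simp only [Submodule.mem_inf, Submodule.mem_iInf, Submodule.mem_comap] at hv ⊢
        exact fun ξ => ρ.T_T_mem hMcl i j
          (fun η' ξ' => ρ.T_mem_generated hj η' (hv.2 ξ')) ξ η
    exact (Submodule.mem_iInf _).mp (hle hv) ξ
  -- On `M` the operator `T~⁽ⁱ⁾*` takes values in `E_i ⊗ M`; this makes `M` reducing.
  have hproj : ∀ i, M ≤ ((ρ.T i).image M).comap (ρ.T i).proj.toLinearMap := by
    intro i
    refine ρ.generated_le (fun v hv => ?_)
      (((ρ.T i).isClosed_image M).preimage (ρ.T i).proj.continuous) fun j hj ξ v hv => ?_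
    · change (ρ.T i).proj v ∈ (ρ.T i).image M
      by_cases hi : i ∈ α
      · rw [mem_wandering.mp hv.2 i hi]; exact zero_mem _
      · exact (ρ.T i).image_mono hWM ((ρ.T i).proj_mem_image_of_adjoint_mem
          (hK.isClosed.inter (ρ.isClosed_wandering α)) hWσ (hWadj i hi) hv)
    · change (ρ.T i).proj _ ∈ (ρ.T i).image M
      by_cases hij : j = i
      · subst hij
        rw [IsometricMap.proj_T]
        exact (ρ.T j).T_mem_image ξ hv.1
      · rw [hc j i hij ξ v (hMK hv.1)]
        exact (ρ.T i).image_le (N := ((ρ.T i).image M).comap ((ρ.T j).T ξ).toLinearMap)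
          (((ρ.T i).isClosed_image M).preimage ((ρ.T j).T ξ).continuous)
          (fun η u hu => ρ.T_T_mem ((ρ.T i).isClosed_image M) j i
            (fun η' ξ' => (ρ.T i).T_mem_image η' (ρ.T_mem_generated hj ξ' hu)) ξ η) hv.2
  refine ⟨reduces_of_adjoint_mem hMcl (fun a v hv => hσ a hv) hT fun i ξ v hv => ?_,
    hc.mono hMK, fun i hi => ?_, ρ.generated_mono (le_inf hWM inf_le_right)⟩
  · rw [← IsometricMap.adjoint_T_proj]
    exact (ρ.T i).adjoint_T_mem_of_mem_image hMcl (fun a v hv => hσ a hv) ξ (hproj i hv)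
  · refine ρ.generated_le (M := LinearMap.eqLocus (ρ.T i).proj.toLinearMap LinearMap.id)
      (hW i hi) (isClosed_eq (ρ.T i).proj.continuous continuous_id) fun j hj ξ v hv => ?_
    change (ρ.T i).proj _ = _
    rw [hc j i (ne_of_mem_of_not_mem hj hi) ξ v (hMK hv.1)]
    exact congrArg _ hv.2

/-- The type of the summand is a maximal `α` for which `K` contains nonzero wandering vectors. -/
lemma exists_woldOn (hK : ρ.Reduces K) (hc : ρ.CommutesOn K) (h0 : K ≠ ⊥) :
    ∃ α M, M ≤ K ∧ M ≠ ⊥ ∧ ρ.WoldOn α M := by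
  obtain ⟨α, hα, hmax⟩ := (Set.toFinite
    {α : Finset (Fin k) | K ⊓ ρ.wandering α ≠ ⊥}).exists_maximal ⟨∅, by simpa [wandering]⟩
  refine ⟨α, ρ.generated α (K ⊓ ρ.wandering α), ρ.generated_le inf_le_left hK.isClosed
    fun i _ ξ v hv => hK.T_mem i ξ v hv.2, fun h => hα (le_bot_iff.mp (h ▸ ρ.le_generated)),
    .generated hK hc fun i hi v hv => ?_⟩
  -- The complementary part of `v` is a wandering vector for `α ∪ {i}`, hence zero.
  have hbot : K ⊓ ρ.wandering (insert i α) = ⊥ := by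
    by_contra hne
    exact hi (hmax hne (Finset.subset_insert i α) (Finset.mem_insert_self i α))
  have hmem : v - (ρ.T i).proj v ∈ K ⊓ ρ.wandering (insert i α) := by
    refine ⟨sub_mem hv.1 (hK.proj_mem i hv.1), mem_wandering.mpr fun j hj => ?_⟩
    rcases Finset.mem_insert.mp hj with rfl | hj
    · rw [map_sub, IsometricMap.proj_proj, sub_self]
    · rw [map_sub, hc.proj_proj hK (ne_of_mem_of_not_mem hj hi) hv.1,
        mem_wandering.mp hv.2 j hj, map_zero, sub_self]
  rw [hbot, Submodule.mem_bot, sub_eq_zero] at hmem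
  exact hmem.symm

/-- A doubly commuting summand is the closed linear span of the Wold summands it contains. -/
lemma CommutesOn.le_of_woldOn_le (hK : ρ.Reduces K) (hc : ρ.CommutesOn K)
    (hL : IsClosed (L : Set H)) (h : ∀ α M, ρ.WoldOn α M → M ≤ L) : K ≤ L := by
  set S : Set (Submodule ℂ H) := {M | M ≤ K ∧ ∃ α, ρ.WoldOn α M}
  set C := (sSup S).topologicalClosure
  have hCr : ρ.Reduces C := .closure_sSup fun M hM => hM.2.choose_spec.reduces
  have hCK : C ≤ K := Submodule.topologicalClosure_minimal _ (sSup_le fun M hM => hM.1) hK.isClosed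
  have hCL : C ≤ L := Submodule.topologicalClosure_minimal _
    (sSup_le fun M hM => h _ M hM.2.choose_spec) hL
  have hbot : K ⊓ Cᗮ = ⊥ := by
    by_contra hne
    obtain ⟨α, M, hM, hM0, hMw⟩ :=
      exists_woldOn (hK.inf hCr.orthogonal) (hc.mono inf_le_left) hne
    have hMC : M ≤ C := (le_sSup (show M ∈ S from ⟨hM.trans inf_le_left, α, hMw⟩)).trans
      (Submodule.le_topologicalClosure _)
    exact hM0 (le_bot_iff.mp ((le_inf hMC (hM.trans inf_le_right)).trans
      (Submodule.inf_orthogonal_eq_bot C).le))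
  have := hCr.completeSpace
  intro v hv
  have hmem : v - C.starProjection v ∈ K ⊓ Cᗮ :=
    ⟨sub_mem hv (hCK (Submodule.starProjection_apply_mem C v)),
      Submodule.sub_starProjection_mem_orthogonal v⟩
  rw [hbot, Submodule.mem_bot, sub_eq_zero] at hmem
  rw [hmem]
  exact hCL (Submodule.starProjection_apply_mem C v)

end IsometricRep

end Representation

/-! ### Multi-indices -/

lemma gen_add_sub {k : ℕ} {n : Fin k → ℕ} {i : Fin k} (h : n i ≠ 0) : gen i + (n - gen i) = n := by
  funext j
  by_cases hj : j = i
  · subst hj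
    simp only [Pi.add_apply, Pi.sub_apply, Pi.single_eq_same]
    omega
  · simp [Pi.single_eq_of_ne hj]

lemma sub_gen_of_eq {k : ℕ} {n p : Fin k → ℕ} {i : Fin k} (h : gen i + n = p) :
    p - gen i = n := by
  rw [← h, add_tsub_cancel_left]

lemma sum_gen_add {k : ℕ} (i : Fin k) (n : Fin k → ℕ) :
    ∑ j, (gen i + n) j = ∑ j, n j + 1 := by
  simp [Finset.sum_add_distrib, add_comm]

lemma exists_ne_zero_of_sum {k N : ℕ} {n : Fin k → ℕ} (h : ∑ j, n j = N + 1) : ∃ i, n i ≠ 0 := by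
  by_contra! h0
  simp [h0] at h

lemma sum_sub_gen {k N : ℕ} {n : Fin k → ℕ} {i : Fin k} (hi : n i ≠ 0) (h : ∑ j, n j = N + 1) :
    ∑ j, (n - gen i) j = N := by
  rw [← gen_add_sub hi, sum_gen_add] at h
  omega

lemma eq_zero_of_sum {k : ℕ} {n : Fin k → ℕ} (h : ∑ j, n j = 0) : n = 0 := by
  funext i
  exact Finset.sum_eq_zero_iff.mp h i (Finset.mem_univ i)

section Representation

variable {A : Type*} [NonUnitalCStarAlgebra A] [PartialOrder A] [StarOrderedRing A]
  {k : ℕ} {E : (Fin k → ℕ) → Type*} [∀ n, NormedAddCommGroup (E n)] [∀ n, NormedSpace ℂ (E n)]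
  [∀ n, SMul Aᵐᵒᵖ (E n)] [∀ n, CStarCorrespondence A (E n)]
  {H : Type*} [NormedAddCommGroup H] [InnerProductSpace ℂ H] [CompleteSpace H]

namespace IsometricRep

variable {𝓔 : ProductSystem A E} (ρ : IsometricRep 𝓔 H)

/-! ### The representation on all fibres -/

/-- The isometric map of the fibre over `n` for `|n| = N`, by recursion on `N`: one generator `e_i`
with `n_i ≠ 0` is split off. -/
def fibreAux : (N : ℕ) → (n : Fin k → ℕ) → ∑ j, n j = N → IsometricMap (E n) ρ.σ
  | 0, _, h => (eq_zero_of_sum h).symm ▸ IsometricMap.ofUnit 𝓔 ρ.σ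
  | N + 1, _, h =>
    (ρ.T (exists_ne_zero_of_sum h).choose).prod 𝓔
      (fibreAux N _ (sum_sub_gen (exists_ne_zero_of_sum h).choose_spec h))
      (gen_add_sub (exists_ne_zero_of_sum h).choose_spec)

/-- The choice of the generator in `fibreAux` does not matter. -/
lemma fibreAux_tilde_creation (N : ℕ) (n p : Fin k → ℕ) (hn : ∑ j, n j = N)
    (hp : ∑ j, p j = N + 1) (i : Fin k) (h : gen i + n = p) (ξ : E (gen i))
    (x : Tensor (E n) ρ.σ) :
    (ρ.fibreAux (N + 1) p hp).tilde (𝓔.creation ρ.σ h ξ x) =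
      (ρ.T i).T ξ ((ρ.fibreAux N n hn).tilde x) := by
  induction N generalizing n p i with
  | zero =>
    have hj := (exists_ne_zero_of_sum hp).choose_spec
    have hd : ρ.fibreAux (0 + 1) p hp = (ρ.T (exists_ne_zero_of_sum hp).choose).prod 𝓔
      (ρ.fibreAux 0 _ (sum_sub_gen hj hp)) (gen_add_sub hj) := rfl
    rw [hd]
    generalize (exists_ne_zero_of_sum hp).choose = j at hj ⊢
    obtain rfl := eq_zero_of_sum hn
    have hij : j = i := by
      by_contra hne
      exact hj (by rw [← h]; simp [Pi.single_eq_of_ne hne])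
    subst hij
    have hn' : p - gen j = 0 := sub_gen_of_eq h
    generalize sum_sub_gen hj hp = e1
    generalize gen_add_sub hj = e2
    revert e1 e2
    rw [hn']
    intro e1 e2
    rw [IsometricMap.prod_tilde_creation]
  | succ N ih =>
    have hj := (exists_ne_zero_of_sum hp).choose_spec
    have hd : ρ.fibreAux (N + 1 + 1) p hp = (ρ.T (exists_ne_zero_of_sum hp).choose).prod 𝓔
      (ρ.fibreAux (N + 1) _ (sum_sub_gen hj hp)) (gen_add_sub hj) := rfl
    by_cases hij : (exists_ne_zero_of_sum hp).choose = i
    · rw [hd]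
      generalize (exists_ne_zero_of_sum hp).choose = j at hj hij ⊢
      subst hij
      obtain rfl : p - gen j = n := sub_gen_of_eq h
      rw [IsometricMap.prod_tilde_creation]
    -- Write `n = e_j + n'` with the generator `e_j` that is split off from `p`; then both sides are
    -- determined by the fibre over `e_i + e_j`, where `T⁽ⁱ⁾` and `T⁽ʲ⁾` can be exchanged.
    have key : ∀ (q) (y : Tensor (E q) ρ.σ) (hq : ∑ l, q l = N + 1)
        (e : gen (exists_ne_zero_of_sum hp).choose + q = p) (η),
        (ρ.fibreAux (N + 1 + 1) p hp).tilde (𝓔.creation ρ.σ e η y) =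
          (ρ.T (exists_ne_zero_of_sum hp).choose).T η ((ρ.fibreAux (N + 1) q hq).tilde y) := by
      intro q y hq e η
      obtain rfl : p - gen (exists_ne_zero_of_sum hp).choose = q := sub_gen_of_eq e
      rw [hd, IsometricMap.prod_tilde_creation]
    generalize (exists_ne_zero_of_sum hp).choose = j at hj hij key
    have hnj : n j ≠ 0 := by
      rw [← h] at hj
      simpa [Pi.single_eq_of_ne hij] using hj
    obtain ⟨n', rfl⟩ : ∃ n', gen j + n' = n := ⟨_, gen_add_sub hnj⟩
    have hn' : ∑ l, n' l = N := by rw [sum_gen_add] at hn; omega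
    have hin' : ∑ l, (gen i + n') l = N + 1 := by rw [sum_gen_add, hn']
    have e : gen j + (gen i + n') = p := by rw [← h]; abel
    have e' : (gen i + gen j) + n' = p := by rw [← h]; abel
    suffices hop : (ρ.fibreAux (N + 1 + 1) p hp).tilde ∘L 𝓔.creation ρ.σ h ξ =
        (ρ.T i).T ξ ∘L (ρ.fibreAux (N + 1) _ hn).tilde from congrArg (fun f => f x) hop
    refine 𝓔.creation_ext ρ.σ rfl fun η y => ?_
    rw [ContinuousLinearMap.comp_apply, ContinuousLinearMap.comp_apply,
      ih n' _ hn' hn j rfl, 𝓔.creation_creation ρ.σ rfl e', ← IsometricMap.prod_mul 𝓔 _ _ rfl,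
      prod_comm, ← 𝓔.creationR_apply, ← IsometricMap.applyL_apply]
    suffices hop : (ρ.fibreAux (N + 1 + 1) p hp).tilde ∘L 𝓔.creationR ρ.σ e' y =
        ((ρ.T j).prod 𝓔 (ρ.T i) (add_comm (gen j) (gen i))).applyL
          ((ρ.fibreAux N n' hn').tilde y) from DFunLike.congr_fun hop _
    refine 𝓔.mul_ext (add_comm (gen j) (gen i)) fun η ξ => ?_
    rw [ContinuousLinearMap.comp_apply, 𝓔.creationR_apply, IsometricMap.applyL_apply,
      IsometricMap.prod_mul, ← 𝓔.creation_creation ρ.σ _ e' rfl e, key _ _ hin',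
      ih n' _ hn' hin' i rfl]

/-- The isometric map of the fibre over `n`, with `ξ₁ ⋯ ξₘ ↦ T(ξ₁) ⋯ T(ξₘ)` for `ξ_l` in fibres
over generators. -/
def fibre (n : Fin k → ℕ) : IsometricMap (E n) ρ.σ := ρ.fibreAux _ n rfl

lemma fibre_eq {N : ℕ} {n : Fin k → ℕ} (h : ∑ j, n j = N) : ρ.fibre n = ρ.fibreAux N n h := by
  subst h
  rfl

lemma fibre_mul {n p : Fin k → ℕ} {i : Fin k} (h : gen i + n = p) (ξ : E (gen i)) (η : E n)
    (v : H) : (ρ.fibre p).T (𝓔.mul h ξ η) v = (ρ.T i).T ξ ((ρ.fibre n).T η v) := by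
  have hp : ∑ j, p j = ∑ j, n j + 1 := by rw [← h, sum_gen_add]
  rw [← IsometricMap.tilde_tmul, ← 𝓔.creation_tmul, ρ.fibre_eq hp,
    ρ.fibreAux_tilde_creation _ n p rfl hp i h, ← IsometricMap.tilde_tmul (ρ.fibre n)]
  rfl

lemma fibre_unit (a : A) (v : H) : (ρ.fibre 0).T (𝓔.unit a) v = ρ.σ a v := by
  rw [ρ.fibre_eq (N := 0) (by simp)]
  exact IsometricMap.ofUnit_T 𝓔 a v

end IsometricRep

end Representation

section Representation

variable {A : Type*} [NonUnitalCStarAlgebra A] [PartialOrder A] [StarOrderedRing A]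
  {k : ℕ} {E : (Fin k → ℕ) → Type*} [∀ n, NormedAddCommGroup (E n)] [∀ n, NormedSpace ℂ (E n)]
  [∀ n, SMul Aᵐᵒᵖ (E n)] [∀ n, CStarCorrespondence A (E n)]

namespace IsometricRep

/-! ### Wold summands are induced -/

section OfWoldOn

variable {H : Type*} [NormedAddCommGroup H] [InnerProductSpace ℂ H] [CompleteSpace H]
  {𝓔 : ProductSystem A E} (ρ : IsometricRep 𝓔 H) (α : Finset (Fin k))

instance : CompleteSpace (ρ.wandering α) := (ρ.isClosed_wandering α).completeSpace_coe

/-- The restriction of `σ` to the wandering subspace for `α`. -/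
def wanderingRep : A →⋆ₙₐ[ℂ] (ρ.wandering α →L[ℂ] ρ.wandering α) where
  toFun a := (ρ.σ a).restrict fun _ => ρ.σ_mem_wandering a
  map_smul' c a := by ext; simp
  map_zero' := by ext; simp
  map_add' a b := by ext; simp
  map_mul' a b := by ext; simp
  map_star' a := by
    rw [ContinuousLinearMap.star_eq_adjoint, ContinuousLinearMap.eq_adjoint_iff]
    intro x y
    change ⟪ρ.σ (star a) x, (y : H)⟫_ℂ = ⟪(x : H), ρ.σ a y⟫_ℂ
    rw [IsometricMap.inner_σ, star_star]

lemma wanderingRep_nondegenerate : Nondegenerate (ρ.wanderingRep α) := by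
  rw [Nondegenerate, Submodule.dense_iff_topologicalClosure_eq_top,
    Submodule.topologicalClosure_eq_top_iff, Submodule.eq_bot_iff]
  intro v hv
  -- Testing `v` against `π(a) π(a*) v` gives `σ(a*) v = 0`, so `v` is orthogonal to `σ(A) H`.
  have h0 : ∀ a, ρ.σ (star a) v = 0 := by
    intro a
    have h := (Submodule.mem_orthogonal' _ _).mp hv _
      (Submodule.subset_span ⟨a, ρ.wanderingRep α (star a) v, rfl⟩)
    rw [← star_star a, ← IsometricMap.inner_σ, star_star, inner_self_eq_zero] at h
    exact congrArg Subtype.val h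
  have h1 : innerSL ℂ (v : H) = 0 := by
    ext w
    refine ρ.nondegenerate.induction (P := fun w => innerSL ℂ (v : H) w = 0) ?_ ?_ w
    · intro w hw
      refine Submodule.span_le (p := LinearMap.ker (innerSL ℂ (v : H)).toLinearMap).mpr ?_ hw
      rintro _ ⟨a, u, rfl⟩
      change ⟪(v : H), ρ.σ a u⟫_ℂ = 0
      rw [← star_star a, ← IsometricMap.inner_σ, h0, inner_zero_left]
    · exact isClosed_eq (innerSL ℂ (v : H)).continuous continuous_const
  have h2 : ⟪(v : H), (v : H)⟫_ℂ = 0 := DFunLike.congr_fun h1 (v : H)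
  exact Subtype.ext (inner_self_eq_zero.mp h2)

/-- The isometry `E n ⊗ W → H`, `η ⊗ v ↦ T(η) v`, for the wandering subspace `W`. -/
def wanderingEmbedding (n : Fin k → ℕ) : Tensor (E n) (ρ.wanderingRep α) →ₗᵢ[ℂ] H :=
  Tensor.liftIsometry (ρ.wanderingRep α)
    (((ContinuousLinearMap.coeLM ℂ).comp (ρ.fibre n).T).compl₂ (ρ.wandering α).subtype)
    (fun ξ η v w => (ρ.fibre n).inner_T ξ η v w)

lemma wanderingEmbedding_tmul (n : Fin k → ℕ) (η : E n) (v : ρ.wandering α) :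
    ρ.wanderingEmbedding α n (Tensor.tmul _ η v) = (ρ.fibre n).T η v :=
  Tensor.liftIsometry_tmul _ _ _ η v

lemma wanderingEmbedding_creation {n p : Fin k → ℕ} {i : Fin k} (h : gen i + n = p)
    (ξ : E (gen i)) (x : Tensor (E n) (ρ.wanderingRep α)) :
    ρ.wanderingEmbedding α p (𝓔.creation _ h ξ x) =
      (ρ.T i).T ξ (ρ.wanderingEmbedding α n x) := by
  have : (ρ.wanderingEmbedding α p).toContinuousLinearMap ∘L 𝓔.creation _ h ξ =
      (ρ.T i).T ξ ∘L (ρ.wanderingEmbedding α n).toContinuousLinearMap :=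
    Tensor.ext _ fun η v => by
      change ρ.wanderingEmbedding α p (𝓔.creation _ h ξ _) =
        (ρ.T i).T ξ (ρ.wanderingEmbedding α n _)
      rw [𝓔.creation_tmul, wanderingEmbedding_tmul, wanderingEmbedding_tmul, fibre_mul]
  exact DFunLike.congr_fun this x

lemma wanderingEmbedding_left (n : Fin k → ℕ) (a : A) (x : Tensor (E n) (ρ.wanderingRep α)) :
    ρ.wanderingEmbedding α n (Tensor.left (E n) _ a x) = ρ.σ a (ρ.wanderingEmbedding α n x) := by
  have : (ρ.wanderingEmbedding α n).toContinuousLinearMap ∘L Tensor.left (E n) _ a =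
      ρ.σ a ∘L (ρ.wanderingEmbedding α n).toContinuousLinearMap :=
    Tensor.ext _ fun η v => by
      change ρ.wanderingEmbedding α n (Tensor.left (E n) _ a _) =
        ρ.σ a (ρ.wanderingEmbedding α n _)
      rw [Tensor.left_tmul, wanderingEmbedding_tmul, wanderingEmbedding_tmul, IsometricMap.σ_T]
  exact DFunLike.congr_fun this x

lemma wanderingEmbedding_unit (a : A) (v : ρ.wandering α) :
    ρ.wanderingEmbedding α 0 (Tensor.tmul _ (𝓔.unit a) v) = ρ.σ a v := by
  rw [wanderingEmbedding_tmul, fibre_unit]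

variable {ρ α}

/-- Vectors of the summand over `n` with `n_j = 0` are orthogonal to the range of `T~⁽ʲ⁾`. -/
lemma proj_wanderingEmbedding (hc : ρ.CommutesOn ⊤) {j : Fin k} (hj : j ∈ α) {N : ℕ}
    {n : Fin k → ℕ} (hN : ∑ l, n l = N) (hnj : n j = 0)
    (x : Tensor (E n) (ρ.wanderingRep α)) :
    (ρ.T j).proj (ρ.wanderingEmbedding α n x) = 0 := by
  induction N generalizing n with
  | zero =>
    obtain rfl := eq_zero_of_sum hN
    refine Tensor.mem_of_tmul_mem _ (M := LinearMap.ker ((ρ.T j).proj ∘L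
      (ρ.wanderingEmbedding α 0).toContinuousLinearMap).toLinearMap)
      (ContinuousLinearMap.isClosed_ker _) (fun ζ v => ?_) x
    obtain ⟨a, rfl⟩ := 𝓔.unit.surjective ζ
    change (ρ.T j).proj (ρ.wanderingEmbedding α 0 _) = 0
    rw [wanderingEmbedding_unit]
    exact mem_wandering.mp (ρ.σ_mem_wandering a v.2) j hj
  | succ N ih =>
    obtain ⟨i, hi⟩ := exists_ne_zero_of_sum hN
    refine 𝓔.mem_of_creation_mem _ (gen_add_sub hi) (M := LinearMap.ker ((ρ.T j).proj ∘L
      (ρ.wanderingEmbedding α n).toContinuousLinearMap).toLinearMap)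
      (ContinuousLinearMap.isClosed_ker _) (fun ξ y => ?_) x
    change (ρ.T j).proj (ρ.wanderingEmbedding α n _) = 0
    rw [wanderingEmbedding_creation, hc i j (fun h => hi (h ▸ hnj)) _ _ trivial,
      ih (sum_sub_gen hi hN) (by simp [hnj]), map_zero]

/-- Common factors from the fibre over `e_j` are removed until the left vector is orthogonal to the
range of `T~⁽ʲ⁾`, which contains the right one. -/
lemma inner_wanderingEmbedding_of_lt (hc : ρ.CommutesOn ⊤) {j : Fin k} (hj : j ∈ α) {c : ℕ}
    {n m : Fin k → ℕ} (hn : n j = c) (hm : c < m j)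
    (x : Tensor (E n) (ρ.wanderingRep α)) (y : Tensor (E m) (ρ.wanderingRep α)) :
    ⟪ρ.wanderingEmbedding α n x, ρ.wanderingEmbedding α m y⟫_ℂ = 0 := by
  induction c generalizing n m with
  | zero =>
    refine 𝓔.mem_of_creation_mem _ (gen_add_sub hm.ne') (M := LinearMap.ker
      (innerSL ℂ (ρ.wanderingEmbedding α n x) ∘L
        (ρ.wanderingEmbedding α m).toContinuousLinearMap).toLinearMap)
      (ContinuousLinearMap.isClosed_ker _) (fun ξ z => ?_) y
    change ⟪ρ.wanderingEmbedding α n x, ρ.wanderingEmbedding α m _⟫_ℂ = 0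
    rw [wanderingEmbedding_creation, ← IsometricMap.proj_T, ← IsometricMap.inner_proj,
      proj_wanderingEmbedding hc hj rfl hn, inner_zero_left]
  | succ c ih =>
    have hn0 : n j ≠ 0 := by omega
    have hm0 : m j ≠ 0 := by omega
    rw [inner_eq_zero_symm]
    refine 𝓔.mem_of_creation_mem _ (gen_add_sub hn0) (M := LinearMap.ker
      (innerSL ℂ (ρ.wanderingEmbedding α m y) ∘L
        (ρ.wanderingEmbedding α n).toContinuousLinearMap).toLinearMap)
      (ContinuousLinearMap.isClosed_ker _) (fun ξ x' => ?_) x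
    change ⟪ρ.wanderingEmbedding α m y, ρ.wanderingEmbedding α n _⟫_ℂ = 0
    rw [inner_eq_zero_symm]
    refine 𝓔.mem_of_creation_mem _ (gen_add_sub hm0) (M := LinearMap.ker
      (innerSL ℂ (ρ.wanderingEmbedding α n (𝓔.creation _ (gen_add_sub hn0) ξ x')) ∘L
        (ρ.wanderingEmbedding α m).toContinuousLinearMap).toLinearMap)
      (ContinuousLinearMap.isClosed_ker _) (fun η y' => ?_) y
    change ⟪ρ.wanderingEmbedding α n _, ρ.wanderingEmbedding α m _⟫_ℂ = 0
    rw [wanderingEmbedding_creation, wanderingEmbedding_creation, IsometricMap.inner_T,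
      ← wanderingEmbedding_left]
    exact ih (by simp [hn]) (by simp; omega) _ _

lemma orthogonalFamily_wanderingEmbedding (hc : ρ.CommutesOn ⊤) :
    OrthogonalFamily ℂ (fun n : SubIndex α => Tensor (E n.1) (ρ.wanderingRep α))
      fun n => ρ.wanderingEmbedding α n.1 := by
  intro n m hnm x y
  obtain ⟨j, hj⟩ : ∃ j, n.1 j ≠ m.1 j := by
    by_contra! h
    exact hnm (Subtype.ext (funext h))
  have hjα : j ∈ α := by
    by_contra hα
    exact hj (by rw [n.2 j hα, m.2 j hα])
  rcases hj.lt_or_gt with h | h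
  · exact inner_wanderingEmbedding_of_lt hc hjα rfl h x y
  · rw [inner_eq_zero_symm]
    exact inner_wanderingEmbedding_of_lt hc hjα rfl h y x

/-- The closed linear span of the ranges contains the wandering subspace, because `σ` is
nondegenerate on it, and is invariant under the `T⁽ⁱ⁾(ξ)`, `i ∈ α`. -/
lemma WoldOn.isHilbertSum (h : ρ.WoldOn α ⊤) :
    IsHilbertSum ℂ (fun n : SubIndex α => Tensor (E n.1) (ρ.wanderingRep α))
      fun n => ρ.wanderingEmbedding α n.1 := by
  refine .mk (orthogonalFamily_wanderingEmbedding h.commutes)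
    (h.le_generated.trans (ρ.generated_le ?_ (Submodule.isClosed_topologicalClosure _) ?_))
  · rw [top_inf_eq]
    intro v hv
    set C := (⨆ n : SubIndex α,
      LinearMap.range (ρ.wanderingEmbedding α n.1).toLinearMap).topologicalClosure
    have hcl : IsClosed (C.comap (ρ.wandering α).subtype : Set (ρ.wandering α)) :=
      (Submodule.isClosed_topologicalClosure _).preimage continuous_subtype_val
    have hle : Submodule.span ℂ {g | ∃ a u, ρ.wanderingRep α a u = g} ≤
        C.comap (ρ.wandering α).subtype := by
      rw [Submodule.span_le]
      rintro _ ⟨a, u, rfl⟩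
      refine Submodule.le_topologicalClosure _
        (Submodule.mem_iSup_of_mem (⟨0, fun _ _ => rfl⟩ : SubIndex α) ?_)
      exact ⟨Tensor.tmul _ (𝓔.unit a) u, ρ.wanderingEmbedding_unit α a u⟩
    exact hcl.closure_subset_iff.mpr (fun z hz => hle hz)
      (ρ.wanderingRep_nondegenerate α ⟨v, hv⟩)
  · intro i hi ξ v hv
    have hle : (⨆ n : SubIndex α,
          LinearMap.range (ρ.wanderingEmbedding α n.1).toLinearMap).topologicalClosure ≤
        (⨆ n : SubIndex α,
          LinearMap.range (ρ.wanderingEmbedding α n.1).toLinearMap).topologicalClosure.comap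
            ((ρ.T i).T ξ).toLinearMap := by
      refine Submodule.topologicalClosure_minimal _ (iSup_le fun n => ?_)
        ((Submodule.isClosed_topologicalClosure _).preimage ((ρ.T i).T ξ).continuous)
      rintro _ ⟨x, rfl⟩
      refine Submodule.le_topologicalClosure _
        (Submodule.mem_iSup_of_mem (⟨gen i + n.1, fun l hl => ?_⟩ : SubIndex α) ?_)
      · simp [n.2 l hl, Pi.single_eq_of_ne (ne_of_mem_of_not_mem hi hl).symm]
      · exact ⟨𝓔.creation _ rfl ξ x, ρ.wanderingEmbedding_creation α rfl ξ x⟩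
    exact hle hv.2

end OfWoldOn

lemma WoldOn.isInduced {H : Type w} [NormedAddCommGroup H] [InnerProductSpace ℂ H]
    [CompleteSpace H] {𝓔 : ProductSystem A E} {ρ : IsometricRep 𝓔 H} {α : Finset (Fin k)}
    (h : ρ.WoldOn α ⊤) : ρ.IsInduced α := by
  refine ⟨ρ.wandering α, inferInstance, inferInstance, inferInstance, ρ.wanderingRep α,
    h.isHilbertSum.linearIsometryEquiv.symm, ρ.wanderingRep_nondegenerate α,
    fun a n x => ?_, fun i hi ξ n p hp x => ?_⟩
  · rw [IsHilbertSum.linearIsometryEquiv_symm_apply_single,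
      IsHilbertSum.linearIsometryEquiv_symm_apply_single, wanderingEmbedding_left]
  · rw [IsHilbertSum.linearIsometryEquiv_symm_apply_single,
      IsHilbertSum.linearIsometryEquiv_symm_apply_single, wanderingEmbedding_creation]

/-! ### Induced representations are doubly commuting -/

section Induced

variable {H : Type*} [NormedAddCommGroup H] [InnerProductSpace ℂ H] [CompleteSpace H]
  {𝓔 : ProductSystem A E} {ρ : IsometricRep 𝓔 H}

/-- If `T~⁽ⁱ⁾` is a unitary, then `T⁽ⁱ⁾(ξ)` commutes with the range projection of `T~⁽ʲ⁾`. -/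
lemma proj_T_of_coisometric {i : Fin k} (hi : ∀ v, (ρ.T i).proj v = v) (j : Fin k)
    (ξ : E (gen i)) (v : H) :
    (ρ.T j).proj ((ρ.T i).T ξ v) = (ρ.T i).T ξ ((ρ.T j).proj v) := by
  refine (ρ.T j).proj_eq_of_mem (M := ⊤) ?_ fun η => ?_
  · exact (ρ.T j).image_le (N := ((ρ.T j).image ⊤).comap ((ρ.T i).T ξ).toLinearMap)
      (((ρ.T j).isClosed_image ⊤).preimage ((ρ.T i).T ξ).continuous)
      (fun η u _ => ρ.T_T_mem ((ρ.T j).isClosed_image ⊤) i j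
        (fun η' ξ' => (ρ.T j).T_mem_image η' trivial) ξ η) ((ρ.T j).proj_mem_image v)
  · rw [← map_sub]
    have hu : ∀ η', ContinuousLinearMap.adjoint ((ρ.T j).T η') (v - (ρ.T j).proj v) = 0 :=
      fun η' => by rw [map_sub, IsometricMap.adjoint_T_proj, sub_self]
    set u := v - (ρ.T j).proj v
    refine ext_inner_right ℂ fun y => ?_
    rw [ContinuousLinearMap.adjoint_inner_left, inner_zero_left, ← hi y]
    refine (ρ.T i).image_le (N := LinearMap.ker
      (innerSL ℂ ((ρ.T i).T ξ u) ∘L (ρ.T j).T η).toLinearMap) (ContinuousLinearMap.isClosed_ker _)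
      (fun ζ g _ => ?_) ((ρ.T i).proj_mem_image y)
    refine ρ.T_T_mem (N := LinearMap.ker (innerSL ℂ ((ρ.T i).T ξ u)).toLinearMap)
      (ContinuousLinearMap.isClosed_ker _) j i (fun ζ' η' => ?_) η ζ
    change ⟪(ρ.T i).T ξ u, (ρ.T i).T ζ' ((ρ.T j).T η' g)⟫_ℂ = 0
    rw [IsometricMap.inner_T, IsometricMap.σ_T, ← ContinuousLinearMap.adjoint_inner_left, hu,
      inner_zero_left]

variable {α : Finset (Fin k)} {K : Type*} [NormedAddCommGroup K] [InnerProductSpace ℂ K]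
  [CompleteSpace K] {π : A →⋆ₙₐ[ℂ] (K →L[ℂ] K)} (U : Fock E α π ≃ₗᵢ[ℂ] H)

/-- The embedding of the summand `E n ⊗ K` of the Fock space, followed by `U`. -/
def fockSummand (n : SubIndex α) : Tensor (E n.1) π →L[ℂ] H :=
  U.toLinearIsometry.toContinuousLinearMap ∘L
    lp.singleContinuousLinearMap ℂ (fun n : SubIndex α => Tensor (E n.1) π) 2 n

lemma fockSummand_apply (n : SubIndex α) (x : Tensor (E n.1) π) :
    fockSummand U n x = U (lp.single 2 n x) := rfl

lemma mem_of_fockSummand_mem {M : Submodule ℂ H} (hM : IsClosed (M : Set H))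
    (h : ∀ n x, fockSummand U n x ∈ M) (v : H) : v ∈ M := by
  obtain ⟨f, rfl⟩ := U.surjective v
  have hs := (lp.hasSum_single (E := fun n : SubIndex α => Tensor (E n.1) π) (p := 2)
    (by simp) f).mapL U.toLinearIsometry.toContinuousLinearMap
  exact hM.mem_of_tendsto hs (.of_forall fun s => sum_mem fun n _ => h n _)

variable (ρ) in
/-- `U` intertwines the creation operators on the Fock space with the `T⁽ⁱ⁾(ξ)`, `i ∈ α`. -/
def IntertwinesCreation : Prop :=
  ∀ i ∈ α, ∀ (ξ : E (gen i)) (n p : SubIndex α) (h : gen i + n.1 = p.1)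
    (x : Tensor (E n.1) π), U (lp.single 2 p (𝓔.creation π h ξ x)) =
      (ρ.T i).T ξ (U (lp.single 2 n x))

variable {U}

lemma fockSummand_mem_of_ne_zero (hU : ρ.IntertwinesCreation U)
    {n : SubIndex α} {j : Fin k} (hj : n.1 j ≠ 0)
    {M : Submodule ℂ H} (hM : IsClosed (M : Set H))
    (h : ∀ (m : SubIndex α), gen j + m.1 = n.1 → ∀ ξ x, (ρ.T j).T ξ (fockSummand U m x) ∈ M)
    (x : Tensor (E n.1) π) : fockSummand U n x ∈ M := by
  have hjα : j ∈ α := by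
    by_contra hα
    exact hj (n.2 j hα)
  refine 𝓔.mem_of_creation_mem π (gen_add_sub hj) (M := M.comap (fockSummand U n).toLinearMap)
    (hM.preimage (fockSummand U n).continuous) (fun ξ y => ?_) x
  let m : SubIndex α := ⟨n.1 - gen j, fun l hl => by simp [n.2 l hl]⟩
  have := h m (gen_add_sub hj) ξ y
  rwa [fockSummand_apply, ← hU j hjα ξ m n (gen_add_sub hj) y] at this

lemma proj_fockSummand_of_ne_zero (hU : ρ.IntertwinesCreation U)
    {n : SubIndex α} {j : Fin k} (hj : n.1 j ≠ 0)
    (x : Tensor (E n.1) π) : (ρ.T j).proj (fockSummand U n x) = fockSummand U n x :=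
  fockSummand_mem_of_ne_zero hU hj (M := LinearMap.eqLocus (ρ.T j).proj.toLinearMap LinearMap.id)
    (isClosed_eq (ρ.T j).proj.continuous continuous_id) (fun _ _ ξ _ => (ρ.T j).proj_T ξ _) x

lemma proj_fockSummand_of_eq_zero (hU : ρ.IntertwinesCreation U)
    {n : SubIndex α} {j : Fin k} (hjα : j ∈ α) (hj : n.1 j = 0)
    (x : Tensor (E n.1) π) : (ρ.T j).proj (fockSummand U n x) = 0 := by
  rw [IsometricMap.proj_eq_zero_iff]
  intro ξ
  refine ext_inner_right ℂ fun y => ?_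
  rw [ContinuousLinearMap.adjoint_inner_left, inner_zero_left]
  refine mem_of_fockSummand_mem U (M := LinearMap.ker
    (innerSL ℂ (fockSummand U n x) ∘L (ρ.T j).T ξ).toLinearMap)
    (ContinuousLinearMap.isClosed_ker _) (fun m z => ?_) y
  let p : SubIndex α := ⟨gen j + m.1, fun l hl => by
    simp [m.2 l hl, Pi.single_eq_of_ne (ne_of_mem_of_not_mem hjα hl).symm]⟩
  have hnp : n ≠ p := by
    rintro rfl
    simp [p] at hj
  change ⟪fockSummand U n x, (ρ.T j).T ξ (fockSummand U m z)⟫_ℂ = 0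
  rw [fockSummand_apply, fockSummand_apply, ← hU j hjα ξ m p rfl z,
    LinearIsometryEquiv.inner_map_map, lp.inner_single_left, lp.single_apply_ne _ _ _ hnp,
    inner_zero_right]

end Induced

/-- The range projection of `T~⁽ʲ⁾`, `j ∈ α`, is the projection onto the summands over `n` with
`n_j ≠ 0`. -/
lemma woldOn_top_of_isInduced {H : Type w} [NormedAddCommGroup H] [InnerProductSpace ℂ H]
    [CompleteSpace H] {𝓔 : ProductSystem A E} {ρ : IsometricRep 𝓔 H} {α : Finset (Fin k)}
    (h : ρ.IsInduced α) (hα : ∀ i, i ∉ α → ρ.FullyCoisometric i) : ρ.WoldOn α ⊤ := by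
  obtain ⟨K, _, _, _, π, U, -, -, hU⟩ := h
  replace hU : ρ.IntertwinesCreation U := hU
  simp only [fullyCoisometric_iff] at hα
  refine ⟨reduces_of_adjoint_mem isClosed_univ (fun _ _ _ => trivial) (fun _ _ _ _ => trivial)
    (fun _ _ _ _ => trivial), fun i j hij ξ v _ => ?_, fun i hi v _ => hα i hi v, fun v _ => ?_⟩
  · by_cases hj : j ∈ α
    swap
    · rw [hα j hj, hα j hj]
    by_cases hi : i ∈ α
    swap
    · exact proj_T_of_coisometric (hα i hi) j ξ v
    refine mem_of_fockSummand_mem U (M := LinearMap.eqLocus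
      ((ρ.T j).proj ∘L (ρ.T i).T ξ).toLinearMap ((ρ.T i).T ξ ∘L (ρ.T j).proj).toLinearMap)
      (isClosed_eq (ContinuousLinearMap.continuous _) (ContinuousLinearMap.continuous _))
      (fun n x => ?_) v
    change (ρ.T j).proj ((ρ.T i).T ξ (fockSummand U n x)) =
      (ρ.T i).T ξ ((ρ.T j).proj (fockSummand U n x))
    let p : SubIndex α := ⟨gen i + n.1, fun l hl => by
      simp [n.2 l hl, Pi.single_eq_of_ne (ne_of_mem_of_not_mem hi hl).symm]⟩
    have hp : p.1 j = n.1 j := by simp [p, Pi.single_eq_of_ne hij.symm]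
    have hT : (ρ.T i).T ξ (fockSummand U n x) = fockSummand U p (𝓔.creation π rfl ξ x) :=
      (hU i hi ξ n p rfl x).symm
    by_cases hnj : n.1 j = 0
    · rw [proj_fockSummand_of_eq_zero hU hj hnj, map_zero, hT,
        proj_fockSummand_of_eq_zero hU hj (hp.trans hnj)]
    · rw [proj_fockSummand_of_ne_zero hU hnj, hT,
        proj_fockSummand_of_ne_zero hU (hp.trans_ne hnj)]
  · refine mem_of_fockSummand_mem U ρ.isClosed_generated (fun n x => ?_) v
    induction hN : ∑ l, n.1 l generalizing n with
    | zero =>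
      exact ρ.le_generated ⟨trivial, mem_wandering.mpr fun j hj =>
        proj_fockSummand_of_eq_zero hU hj (congrFun (eq_zero_of_sum hN) j) x⟩
    | succ N ih =>
      obtain ⟨j, hj⟩ := exists_ne_zero_of_sum hN
      refine fockSummand_mem_of_ne_zero hU hj ρ.isClosed_generated (fun m hm ξ y => ?_) x
      have hjα : j ∈ α := by
        by_contra hα
        exact hj (n.2 j hα)
      refine ρ.T_mem_generated hjα ξ (ih m y ?_)
      rw [← sub_gen_of_eq hm]
      exact sum_sub_gen hj hN

/-! ### Restriction to a reducing subspace -/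

section Restrict

variable {H : Type*} [NormedAddCommGroup H] [InnerProductSpace ℂ H] [CompleteSpace H]
  {𝓔 : ProductSystem A E} {ρ : IsometricRep 𝓔 H} {K : Submodule ℂ H} (hK : ρ.Reduces K)
  [CompleteSpace K] {α : Finset (Fin k)}

lemma proj_restrict_coe (i : Fin k) (v : K) :
    (((restrict hK).T i).proj v : H) = (ρ.T i).proj v := hK.proj_restrictT_coe i v

lemma T_restrict_coe (i : Fin k) (ξ : E (gen i)) (v : K) :
    (((restrict hK).T i).T ξ v : H) = (ρ.T i).T ξ v := rfl

lemma commutesOn_restrict_iff : (restrict hK).CommutesOn ⊤ ↔ ρ.CommutesOn K := by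
  constructor
  · intro h i j hij ξ v hv
    have := congrArg Subtype.val (h i j hij ξ ⟨v, hv⟩ trivial)
    rwa [proj_restrict_coe, T_restrict_coe, T_restrict_coe, proj_restrict_coe] at this
  · intro h i j hij ξ v _
    apply Subtype.ext
    rw [proj_restrict_coe, T_restrict_coe, T_restrict_coe, proj_restrict_coe]
    exact h i j hij ξ v v.2

lemma mem_wandering_restrict {v : K} :
    v ∈ (restrict hK).wandering α ↔ (v : H) ∈ ρ.wandering α := by
  simp only [mem_wandering, ← proj_restrict_coe hK, Submodule.coe_eq_zero]

lemma generated_restrict_iff : (⊤ : Submodule ℂ K) ≤ (restrict hK).generated α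
      (⊤ ⊓ (restrict hK).wandering α) ↔ K ≤ ρ.generated α (K ⊓ ρ.wandering α) := by
  constructor
  · intro h v hv
    have hle : (restrict hK).generated α (⊤ ⊓ (restrict hK).wandering α) ≤
        (ρ.generated α (K ⊓ ρ.wandering α)).comap K.subtype :=
      (restrict hK).generated_le
        (fun u hu => ρ.le_generated ⟨u.2, (mem_wandering_restrict hK).mp hu.2⟩)
        (ρ.isClosed_generated.preimage continuous_subtype_val)
        (fun i hi ξ u hu => ρ.T_mem_generated hi ξ hu.2)
    exact hle (h (x := ⟨v, hv⟩) trivial)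
  · intro h v _
    have hle : ρ.generated α (K ⊓ ρ.wandering α) ≤
        ((restrict hK).generated α (⊤ ⊓ (restrict hK).wandering α)).map K.subtype := by
      refine ρ.generated_le (fun u hu => ⟨⟨u, hu.1⟩, (restrict hK).le_generated
        ⟨trivial, (mem_wandering_restrict hK).mpr hu.2⟩, rfl⟩) ?_ ?_
      · exact hK.isClosed.isClosedEmbedding_subtypeVal.isClosedMap _
          (restrict hK).isClosed_generated
      · rintro i hi ξ _ ⟨-, u, hu, rfl⟩
        exact ⟨_, (restrict hK).T_mem_generated hi ξ hu, rfl⟩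
    obtain ⟨u, hu, huv⟩ := hle (h v.2)
    rwa [← Subtype.ext huv]

lemma woldOn_restrict_iff : (restrict hK).WoldOn α ⊤ ↔ ρ.WoldOn α K := by
  constructor
  · intro h
    refine ⟨hK, (commutesOn_restrict_iff hK).mp h.commutes, fun i hi v hv => ?_,
      (generated_restrict_iff hK).mp h.le_generated⟩
    rw [← proj_restrict_coe hK i ⟨v, hv⟩, h.proj_eq i hi _ trivial]
  · intro h
    refine ⟨reduces_of_adjoint_mem isClosed_univ (fun _ _ _ => trivial) (fun _ _ _ _ => trivial)
      (fun _ _ _ _ => trivial), (commutesOn_restrict_iff hK).mpr h.commutes,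
      fun i hi v _ => Subtype.ext ?_, (generated_restrict_iff hK).mpr h.le_generated⟩
    rw [proj_restrict_coe, h.proj_eq i hi v v.2]

end Restrict

section Main

variable {H : Type*} [NormedAddCommGroup H] [InnerProductSpace ℂ H] [CompleteSpace H]
  {𝓔 : ProductSystem A E} {ρ : IsometricRep 𝓔 H} {K : Submodule ℂ H} {α : Finset (Fin k)}

lemma isWoldSummand_iff : ρ.IsWoldSummand α K ↔ ρ.WoldOn α K := by
  constructor
  · rintro ⟨hK, hind, hco⟩
    have := hK.completeSpace
    exact (woldOn_restrict_iff hK).mp (woldOn_top_of_isInduced hind hco)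
  · intro h
    have := h.reduces.completeSpace
    have h' := (woldOn_restrict_iff h.reduces).mpr h
    exact ⟨h.reduces, h'.isInduced, fun i hi =>
      (fullyCoisometric_iff _ i).mpr fun v => h'.proj_eq i hi v trivial⟩

lemma isDoublyCommutingSummand_iff :
    ρ.IsDoublyCommutingSummand K ↔ ρ.Reduces K ∧ ρ.CommutesOn K := by
  constructor
  · rintro ⟨hK, h⟩
    have := hK.completeSpace
    exact ⟨hK, (commutesOn_restrict_iff hK).mp ((doublyCommuting_iff _).mp h)⟩
  · rintro ⟨hK, h⟩
    have := hK.completeSpace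
    exact ⟨hK, (doublyCommuting_iff _).mpr ((commutesOn_restrict_iff hK).mpr h)⟩

end Main

/-- A finite sum of pairwise orthogonal closed subspaces is closed. -/
lemma isClosed_iSup_of_isOrtho {ι H : Type*} [Finite ι] [NormedAddCommGroup H]
    [InnerProductSpace ℂ H] [CompleteSpace H] {V : ι → Submodule ℂ H}
    (hV : ∀ i, IsClosed (V i : Set H)) (ho : ∀ i j, i ≠ j → V i ⟂ V j) :
    IsClosed ((⨆ i, V i : Submodule ℂ H) : Set H) := by
  classical
  have := Fintype.ofFinite ι
  have : ∀ i, CompleteSpace (V i) := fun i => (hV i).completeSpace_coe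
  have hle : (⨆ i, V i).topologicalClosure ≤
      LinearMap.eqLocus (∑ i, (V i).starProjection).toLinearMap LinearMap.id := by
    refine Submodule.topologicalClosure_minimal _ (iSup_le fun i v hv => ?_)
      (isClosed_eq (ContinuousLinearMap.continuous _) continuous_id)
    change (∑ j, (V j).starProjection) v = v
    rw [_root_.sum_apply, Finset.sum_eq_single i]
    · exact Submodule.starProjection_eq_self_iff.mpr hv
    · intro j _ hj
      exact (Submodule.starProjection_apply_eq_zero_iff _).mpr (ho i j hj.symm hv)
    · simp
  refine isClosed_of_closure_subset fun v hv => ?_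
  have h : (∑ i, (V i).starProjection) v = v := hle hv
  rw [← h, _root_.sum_apply]
  exact sum_mem fun i _ => Submodule.mem_iSup_of_mem i (Submodule.starProjection_apply_mem _ v)

/-- The largest Wold summand of type `α`: the closed linear span of all of them. -/
def woldPart {H : Type*} [NormedAddCommGroup H] [InnerProductSpace ℂ H] [CompleteSpace H]
    {𝓔 : ProductSystem A E} (ρ : IsometricRep 𝓔 H) (α : Finset (Fin k)) : Submodule ℂ H :=
  (sSup {K | ρ.WoldOn α K}).topologicalClosure

section Main

variable {H : Type*} [NormedAddCommGroup H] [InnerProductSpace ℂ H] [CompleteSpace H]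
  {𝓔 : ProductSystem A E} (ρ : IsometricRep 𝓔 H)

lemma woldOn_woldPart (α : Finset (Fin k)) : ρ.WoldOn α (ρ.woldPart α) :=
  .closure_sSup fun _ hK => hK

lemma WoldOn.le_woldPart {α : Finset (Fin k)} {K : Submodule ℂ H} {ρ : IsometricRep 𝓔 H}
    (hK : ρ.WoldOn α K) : K ≤ ρ.woldPart α :=
  (le_sSup (a := K) hK).trans (Submodule.le_topologicalClosure _)

lemma isClosed_iSup_woldPart : IsClosed ((⨆ α, ρ.woldPart α : Submodule ℂ H) : Set H) :=
  isClosed_iSup_of_isOrtho (fun α => (ρ.woldOn_woldPart α).reduces.isClosed)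
    fun α β h => (ρ.woldOn_woldPart α).isOrtho (ρ.woldOn_woldPart β) h

/-- The sum of the Wold parts is already closed, so it coincides with their closed linear span. -/
lemma isDoublyCommutingSummand_iSup_woldPart :
    ρ.IsDoublyCommutingSummand (⨆ α, ρ.woldPart α) := by
  have h : (sSup (Set.range ρ.woldPart)).topologicalClosure = ⨆ α, ρ.woldPart α :=
    ρ.isClosed_iSup_woldPart.submodule_topologicalClosure_eq
  rw [isDoublyCommutingSummand_iff, ← h]
  exact ⟨.closure_sSup (by rintro _ ⟨α, rfl⟩; exact (ρ.woldOn_woldPart α).reduces),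
    .closure_sSup (by rintro _ ⟨α, rfl⟩; exact (ρ.woldOn_woldPart α).commutes)⟩

end Main

end IsometricRep

end Representation

end Wold

end

theorem corollary3p2 {A : Type*} [NonUnitalCStarAlgebra A] [PartialOrder A] [StarOrderedRing A]
    {k : ℕ} {E : (Fin k → ℕ) → Type*}
    [∀ n, NormedAddCommGroup (E n)] [∀ n, NormedSpace ℂ (E n)] [∀ n, CompleteSpace (E n)]
    [∀ n, SMul Aᵐᵒᵖ (E n)] [∀ n, Wold.CStarCorrespondence A (E n)]
    (𝓔 : Wold.ProductSystem A E)
    {H : Type*} [NormedAddCommGroup H] [InnerProductSpace ℂ H] [CompleteSpace H]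
    (ρ : Wold.IsometricRep 𝓔 H) :
    ∃ Hα : Finset (Fin k) → Submodule ℂ H,
      (∀ α, IsGreatest {K : Submodule ℂ H | ρ.IsWoldSummand α K} (Hα α)) ∧
      (∀ α β, α ≠ β → Hα α ⟂ Hα β) ∧
      IsGreatest {K : Submodule ℂ H | ρ.IsDoublyCommutingSummand K} (⨆ α, Hα α) := by
  refine ⟨ρ.woldPart, fun α => ⟨?_, fun K hK => ?_⟩,
    fun α β h => (ρ.woldOn_woldPart α).isOrtho (ρ.woldOn_woldPart β) h,
    ρ.isDoublyCommutingSummand_iSup_woldPart, fun K hK => ?_⟩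
  · exact Wold.IsometricRep.isWoldSummand_iff.mpr (ρ.woldOn_woldPart α)
  · exact (Wold.IsometricRep.isWoldSummand_iff.mp hK).le_woldPart
  · obtain ⟨hr, hc⟩ := Wold.IsometricRep.isDoublyCommutingSummand_iff.mp hK
    exact hc.le_of_woldOn_le hr ρ.isClosed_iSup_woldPart
      fun α M hM => hM.le_woldPart.trans (le_iSup _ α)
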